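/- For real $x$ write $e(x)=e^{2\pi i x}$ and let $\|x\|$ denote the distance from $x$ to the nearest integer. Let $\Lambda$ be the von Mangoldt function. For real $A>0$ and $P\ge 2$, and integers $1\le a,b\le q$, let $$\mathfrak M(a,b,q)=\Big\{(\alpha,\beta)\in(\mathbb R/\mathbb Z)^2:\ \Big\|\alpha-\frac aq\Big\|\le\frac{(\log P)^A}{qP^2},\ \Big\|\beta-\frac bq\Big\|\le\frac{(\log P)^A}{qP^3}\Big\}.$$ Let the major arcs $\mathfrak M=\mathfrak M_{A,P}$ be the union of all $\mathfrak M(a,b,q)$ with $1\le q<(\log P)^A$, $1\le a\le q$, $1\le b\le q$ and $\gcd(a,b,q)=1$, and let the minor arcs be $\mathfrak m=\mathfrak m_{A,P}=(\mathbb R/\mathbb Z)^2\setminus\mathfrak M$. For every $D>0$ there is $A_0=A_0(D)>0$ such that for every real $A\ge A_0$ there is a constant $C=C(A,D)>0$ for which the following two statements hold for all real $P\ge 2$. (i) For all real $\alpha_1,\alpha_2,\alpha_3$ such that $(\alpha_2,\alpha_3)$ modulo $1$ lies in $\mathfrak m$, $$\Big|\sum_{n\le P}\Lambda(n)\,e(\alpha_1n+\alpha_2n^2+\alpha_3n^3)\Big|\le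 C\,P(\log P)^{-D}.$$ (ii) With $p$ running over primes, $$\sup_{(\alpha,\beta)\in\mathfrak m}\Big|\sum_{p\le P}(\log p)\,e(\alpha p^2+\beta p^3)\Big|\le C\,P(\log P)^{-D}$$ (the supremum is finite, and is taken to be $0$ if $\mathfrak m$ is empty). -/

import Mathlib

open scoped ArithmeticFunction.vonMangoldt

noncomputable section

namespace CubicWeyl

/-- The major arc `𝔐(a, b, q)` in the torus `(ℝ/ℤ)²`; distances are those of `ℝ/ℤ`, that is,
the norm of `UnitAddCircle` is the distance to the nearest integer. -/
def majorArc (A P : ℝ) (a b q : ℕ) : Set (UnitAddCircle × UnitAddCircle) :=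
  {x | ‖x.1 - (((a : ℝ) / q : ℝ) : UnitAddCircle)‖ ≤ Real.log P ^ A / (q * P ^ 2) ∧
       ‖x.2 - (((b : ℝ) / q : ℝ) : UnitAddCircle)‖ ≤ Real.log P ^ A / (q * P ^ 3)}

/-- The union of the major arcs `𝔐(a, b, q)` over all `1 ≤ q < (log P) ^ A`, `1 ≤ a ≤ q`,
`1 ≤ b ≤ q` with `gcd(a, b, q) = 1`. -/
def majorArcs (A P : ℝ) : Set (UnitAddCircle × UnitAddCircle) :=
  {x | ∃ q a b : ℕ, 1 ≤ q ∧ (q : ℝ) < Real.log P ^ A ∧ 1 ≤ a ∧ a ≤ q ∧ 1 ≤ b ∧ b ≤ q ∧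
       Nat.gcd (Nat.gcd a b) q = 1 ∧ x ∈ majorArc A P a b q}

/-- The minor arcs: the remainder of the torus `(ℝ/ℤ)²`. -/
def minorArcs (A P : ℝ) : Set (UnitAddCircle × UnitAddCircle) :=
  (majorArcs A P)ᶜ

/-- `∑_{n ≤ P} Λ(n) e(α₁ n + α₂ n² + α₃ n³)`, where `e(x) = exp(2πix)` is `Real.fourierChar`. -/
def lambdaSum (P α₁ α₂ α₃ : ℝ) : ℂ :=
  ∑ n ∈ Finset.Icc 1 ⌊P⌋₊,
    ((Λ n : ℝ) : ℂ) *
      (Real.fourierChar (α₁ * (n : ℝ) + α₂ * (n : ℝ) ^ 2 + α₃ * (n : ℝ) ^ 3) : ℂ)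

/-- `∑_{p ≤ P} (log p) e(α p² + β p³)`, the sum being over primes `p`. -/
def primeSum (P α β : ℝ) : ℂ :=
  ∑ p ∈ (Finset.Icc 1 ⌊P⌋₊).filter Nat.Prime,
    (Real.log p : ℂ) * (Real.fourierChar (α * (p : ℝ) ^ 2 + β * (p : ℝ) ^ 3) : ℂ)

/-- The values `|∑_{p ≤ P} (log p) e(α p² + β p³)|` for `(α, β)` on the minor arcs. -/
def minorArcValues (A P : ℝ) : Set ℝ :=
  {r | ∃ α β : ℝ, ((α : UnitAddCircle), (β : UnitAddCircle)) ∈ minorArcs A P ∧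
       r = ‖primeSum P α β‖}

end CubicWeyl

end

/-! The argument is by contraposition: if the sum over `Λ` exceeds `P / (log P) ^ m`, then a single
`q`, at most a power of `log P`, brings both `q α₂` and `q α₃` very close to integers, which puts
`(α₂, α₃)` on a major arc once `A` is large. Each step is an inverse statement with a parameter `Q`,
finally a power of `log P`, so losing a fixed power of `Q` is always harmless. Nothing is needed
about `α₁`.

Vaughan's method (`norm_vonMangoldt_sum_le`) splits the sum in two. Small values of the Möbius
variable leave Weyl sums along multiples of a small `d` (`linear_sum_cubic`). Large values leave
bilinear sums, where Cauchy–Schwarz discards the arithmetic weights and produces, for many `k`,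
large Weyl sums in `b` with coefficients `(k³ - k'³) α₃` and `(k² - k'²) α₂` (`bilinear_cubic`).

Two tools finish both cases. The inverse Weyl theorem `weyl_cubic` differences the phase down to a
geometric series; Vinogradov's lemma `linear_recurrence` converts information on `h α` for many `h`
into information on `α`. The quadratic coefficient is reached by passing to residue classes modulo
`q`, where the cubic phase varies slowly. The recurrence lemmas `recurrence_quadratic` and
`recurrence_cubic` treat polynomials close to integers at many points by the same differencing;
applied in the variable `k`, they recover `α₂` and `α₃` in the bilinear case.

Proper prime powers contribute only `O(√P log P)`, and bounded `P` is absorbed in the constant. -/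

namespace CubicWeyl

/-! ### Distance to the nearest integer and linear recurrence -/

/-- The distance from a real number to the nearest integer. -/
noncomputable def distInt (x : ℝ) : ℝ := |x - round x|

theorem distInt_nonneg (x : ℝ) : 0 ≤ distInt x := abs_nonneg _

theorem distInt_le_abs_sub (x : ℝ) (a : ℤ) : distInt x ≤ |x - a| := round_le x a

theorem distInt_le_abs (x : ℝ) : distInt x ≤ |x| := by
  simpa using distInt_le_abs_sub x 0

theorem distInt_le_one (x : ℝ) : distInt x ≤ 1 :=
  (abs_sub_round x).trans (by norm_num)

theorem distInt_add_int (x : ℝ) (a : ℤ) : distInt (x + a) = distInt x := by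
  simp [distInt]

theorem distInt_neg (x : ℝ) : distInt (-x) = distInt x := by
  apply le_antisymm
  · have := distInt_le_abs_sub (-x) (-round x)
    rwa [show -x - ((-round x : ℤ) : ℝ) = -(x - round x) by push_cast; ring, abs_neg] at this
  · have := distInt_le_abs_sub x (-round (-x))
    rwa [show x - ((-round (-x) : ℤ) : ℝ) = -(-x - round (-x)) by push_cast; ring, abs_neg]
      at this

theorem distInt_add_le (x y : ℝ) : distInt (x + y) ≤ distInt x + distInt y := by
  have := distInt_le_abs_sub (x + y) (round x + round y)
  rw [show x + y - ((round x + round y : ℤ) : ℝ) = (x - round x) + (y - round y) by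
    push_cast; ring] at this
  exact this.trans (abs_add_le _ _)

theorem distInt_sub_le (x y : ℝ) : distInt (x - y) ≤ distInt x + distInt y := by
  rw [sub_eq_add_neg, ← distInt_neg y]
  exact distInt_add_le _ _

theorem distInt_natCast_mul_le (k : ℕ) (x : ℝ) : distInt (k * x) ≤ k * distInt x := by
  have := distInt_le_abs_sub (k * x) (k * round x)
  rwa [show k * x - ((k * round x : ℤ) : ℝ) = k * (x - round x) by push_cast; ring, abs_mul,
    Nat.abs_cast] at this

theorem distInt_eq_abs {x : ℝ} (hx : |x| ≤ 1 / 2) : distInt x = |x| := by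
  apply le_antisymm (distInt_le_abs x)
  unfold distInt
  rcases eq_or_ne (round x) 0 with h | h
  · simp [h]
  · have h1 : (1 : ℝ) ≤ |(round x : ℝ)| := by
      exact_mod_cast Int.one_le_abs h
    have h2 : |(round x : ℝ)| ≤ |x| + |x - round x| := by
      have := abs_sub_le 0 x (round x : ℝ)
      simpa using this
    linarith

/-- `x` has a multiple `q x`, `1 ≤ q ≤ Q`, within `ε` of an integer. -/
def Approximable (x Q ε : ℝ) : Prop := ∃ q : ℕ, 1 ≤ q ∧ (q : ℝ) ≤ Q ∧ distInt (q * x) ≤ ε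

theorem Approximable.mono {x Q Q' ε ε' : ℝ} (h : Approximable x Q ε) (hQ : Q ≤ Q')
    (hε : ε ≤ ε') : Approximable x Q' ε' := by
  obtain ⟨q, h1, h2, h3⟩ := h
  exact ⟨q, h1, h2.trans hQ, h3.trans hε⟩

theorem Approximable.of_mul {x Q ε : ℝ} {k : ℕ} (hk : 1 ≤ k) (h : Approximable (k * x) Q ε) :
    Approximable x (k * Q) ε := by
  obtain ⟨q, h1, h2, h3⟩ := h
  refine ⟨k * q, Nat.mul_pos hk h1, ?_, ?_⟩
  · push_cast; gcongr
  · convert h3 using 2; push_cast; ring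

theorem approximable_of_one_le {x Q ε : ℝ} (hQ : 1 ≤ Q) (hε : 1 ≤ ε) : Approximable x Q ε :=
  ⟨1, le_rfl, by simpa using hQ, (distInt_le_one _).trans hε⟩

/-- Pigeonhole: cut `[0, N]` into blocks of length `⌊Q⌋ + 1`; two points of `H ∪ {0}` share a block,
and their difference serves as `q`. Adjoining `0` supplies the one extra point required. -/
theorem exists_difference_le {Q α ε : ℝ} {N : ℕ} {H : Finset ℕ} (hQ : 1 ≤ Q) (hN : 1 ≤ N)
    (hH : H ⊆ Finset.Icc 1 N) (hcard : N / Q ≤ H.card) (hd : ∀ h ∈ H, distInt (h * α) ≤ ε) :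
    ∃ q : ℕ, 1 ≤ q ∧ (q : ℝ) ≤ Q ∧ distInt (q * α) ≤ 2 * ε := by
  have hQ0 : 0 < Q := by linarith
  have hN0 : (0 : ℝ) < N := by exact_mod_cast hN
  set B := ⌊Q⌋₊ + 1 with hB
  have hBQ : Q < B := by rw [hB]; push_cast; exact Nat.lt_floor_add_one Q
  have hNB : N / B < H.card := by
    have h1 : ((N / B : ℕ) : ℝ) ≤ (N : ℝ) / B := Nat.cast_div_le
    have h2 : (N : ℝ) / B < N / Q := by gcongr
    exact_mod_cast (h1.trans_lt h2).trans_le hcard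
  have h0 : 0 ∉ H := fun h => by simpa using hH h
  have hne : H.Nonempty := Finset.card_pos.mp ((Nat.zero_le _).trans_lt hNB)
  have hε : 0 ≤ ε := by
    obtain ⟨h, hh⟩ := hne
    exact (distInt_nonneg _).trans (hd h hh)
  obtain ⟨x, hx, y, hy, hxy, hf⟩ := Finset.exists_ne_map_eq_of_card_lt_of_maps_to
    (s := insert 0 H) (t := Finset.range (N / B + 1)) (f := fun h => h / B)
    (by rw [Finset.card_insert_of_notMem h0, Finset.card_range]; omega)
    (by
      intro h hh
      have hle : h ≤ N := by
        rcases Finset.mem_insert.mp hh with rfl | hh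
        · omega
        · exact (Finset.mem_Icc.mp (hH hh)).2
      simpa [Nat.lt_succ_iff] using Nat.div_le_div_right hle)
  have hd' : ∀ h ∈ insert 0 H, distInt (h * α) ≤ ε := by
    intro h hh
    rcases Finset.mem_insert.mp hh with rfl | hh
    · simpa [distInt] using hε
    · exact hd h hh
  have key : ∀ x ∈ insert 0 H, ∀ y ∈ insert 0 H, x < y → x / B = y / B →
      ∃ q : ℕ, 1 ≤ q ∧ (q : ℝ) ≤ Q ∧ distInt (q * α) ≤ 2 * ε := by
    intro x hx y hy hlt hf
    refine ⟨y - x, by omega, ?_, ?_⟩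
    · have : y - x < B := by
        have h1 := Nat.div_add_mod x B
        have h2 := Nat.div_add_mod y B
        have h3 := Nat.mod_lt y (show 0 < B by omega)
        rw [hf] at h1
        omega
      have : y - x ≤ ⌊Q⌋₊ := by omega
      exact (Nat.cast_le.mpr this).trans (Nat.floor_le hQ0.le)
    · rw [Nat.cast_sub hlt.le, sub_mul]
      linarith [distInt_sub_le (y * α) (x * α), hd' x hx, hd' y hy]
  rcases lt_or_gt_of_ne hxy with h | h
  · exact key x hx y hy h hf
  · exact key y hy x hx h hf.symm

/-- Vinogradov's lemma: if `‖hα‖` is small for a positive proportion of `h ≤ N`, then `α` is close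
to a rational number with small denominator. -/
theorem linear_recurrence {Q α ε : ℝ} {N : ℕ} {H : Finset ℕ} (hQ : 100 ≤ Q) (hN : 1 ≤ N)
    (hH : H ⊆ Finset.Icc 1 N) (hcard : N / Q ≤ H.card) (hε : ε ≤ 1 / Q ^ 2)
    (hd : ∀ h ∈ H, distInt (h * α) ≤ ε) :
    Approximable α Q (Q ^ 3 * ε / N) := by
  have hN0 : (0 : ℝ) < N := by exact_mod_cast hN
  have hQ0 : 0 < Q := by linarith
  obtain ⟨q, hq1, hqQ, hq⟩ := exists_difference_le (by linarith) hN hH hcard hd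
  refine ⟨q, hq1, hqQ, ?_⟩
  set t := distInt (q * α) with ht
  have ht0 : 0 ≤ t := distInt_nonneg _
  have hε0 : 0 ≤ ε := by linarith
  rcases ht0.eq_or_lt with h0 | htpos
  · rw [← h0]; positivity
  have hεpos : 0 < ε := by linarith
  -- `J` is chosen so that a shift by `J q` rotates by `J t`, between `3ε` and `5ε`: more than the
  -- `2ε` separating two points of `H`, yet `K` such shifts stay within half a turn.
  set K := ⌊2 * Q⌋₊ + 1 with hK
  set J := ⌈3 * ε / t⌉₊ with hJ
  have hK1 : 2 * Q < K := by rw [hK]; push_cast; exact Nat.lt_floor_add_one _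
  have hK2 : (K : ℝ) ≤ 2 * Q + 1 := by
    rw [hK]; push_cast; linarith [Nat.floor_le (show 0 ≤ 2 * Q by linarith)]
  have hJ1 : 3 * ε ≤ J * t := by
    rw [← div_le_iff₀ htpos]; exact Nat.le_ceil _
  have hJ2 : J * t ≤ 5 * ε := by
    have h1 : (J : ℝ) < 3 * ε / t + 1 := Nat.ceil_lt_add_one (by positivity)
    have h2 : (J : ℝ) * t ≤ (3 * ε / t + 1) * t := by gcongr
    have h3 : (3 * ε / t + 1) * t = 3 * ε + t := by field_simp
    linarith
  set θ := q * α - round (q * α) with hθ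
  have hθt : |θ| = t := rfl
  have hKε : K * (5 * ε) ≤ 1 / 2 := by
    have h1 : (K : ℝ) * (5 * ε) ≤ (2 * Q + 1) * (5 * (1 / Q ^ 2)) := by gcongr
    have h2 : (2 * Q + 1) * (5 * (1 / Q ^ 2)) ≤ 1 / 2 := by
      rw [show (2 * Q + 1) * (5 * (1 / Q ^ 2)) = (10 * Q + 5) / Q ^ 2 by ring,
        div_le_div_iff₀ (by positivity) (by norm_num)]
      nlinarith
    linarith
  -- Otherwise the translates `H + k J q` for `k < K` are disjoint subsets of `[1, 2N]`, although
  -- their total size exceeds `2Q · N / Q = 2N`.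
  have hbig : N < K * J * q := by
    by_contra! hle
    have hinj : Set.InjOn (fun p : ℕ × ℕ => p.2 + p.1 * J * q) (Finset.range K ×ˢ H : Finset _) := by
      rintro ⟨k, h⟩ hp ⟨k', h'⟩ hp' heq
      simp only [Finset.coe_product, Set.mem_prod, Finset.mem_coe, Finset.mem_range] at hp hp' heq
      rcases eq_or_ne k k' with rfl | hne
      · ext
        · rfl
        · simpa using heq
      exfalso
      have hreal : (h : ℝ) - h' = (k' - k) * J * q := by
        have : (h : ℝ) + k * J * q = h' + k' * J * q := by exact_mod_cast heq
        linear_combination this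
      have e1 : (h : ℝ) * α - h' * α =
          ((k' : ℝ) - k) * J * θ + (((k' - k) * J * round (q * α) : ℤ) : ℝ) := by
        rw [← sub_mul, hreal, hθ]; push_cast; ring
      have h1 := distInt_sub_le (h * α) (h' * α)
      rw [e1, distInt_add_int] at h1
      have habs : |((k' : ℝ) - k) * J * θ| = |(k' : ℝ) - k| * (J * t) := by
        rw [mul_assoc, abs_mul, abs_mul, hθt, Nat.abs_cast]
      have hk1 : (1 : ℝ) ≤ |(k' : ℝ) - k| := by
        have : (k' : ℤ) - k ≠ 0 := by omega
        exact_mod_cast Int.one_le_abs this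
      have hk2 : |(k' : ℝ) - k| ≤ K := by
        have h1 : (k : ℝ) ≤ K := by exact_mod_cast hp.1.le
        have h2 : (k' : ℝ) ≤ K := by exact_mod_cast hp'.1.le
        rw [abs_le]; constructor <;> linarith [Nat.cast_nonneg (α := ℝ) k,
          Nat.cast_nonneg (α := ℝ) k']
      rw [distInt_eq_abs, habs] at h1
      · have : 1 * (3 * ε) ≤ |(k' : ℝ) - k| * (J * t) := by gcongr
        linarith [hd h hp.2, hd h' hp'.2]
      · rw [habs]
        calc |(k' : ℝ) - k| * (J * t) ≤ K * (5 * ε) := by gcongr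
          _ ≤ _ := hKε
    have hmaps : Set.MapsTo (fun p : ℕ × ℕ => p.2 + p.1 * J * q) (Finset.range K ×ˢ H : Finset _)
        (Finset.Icc 1 (2 * N) : Finset ℕ) := by
      rintro ⟨k, h⟩ hp
      simp only [Finset.coe_product, Set.mem_prod, Finset.mem_coe, Finset.mem_range] at hp
      have := Finset.mem_Icc.mp (hH hp.2)
      have h2 : k * J * q ≤ K * J * q := by
        gcongr; exact hp.1.le
      simp only [Finset.coe_Icc, Set.mem_Icc]
      omega
    have hc := Finset.card_le_card_of_injOn _ hmaps hinj
    rw [Finset.card_product, Finset.card_range, Nat.card_Icc] at hc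
    have hc' : (K : ℝ) * H.card ≤ 2 * N := by exact_mod_cast (by omega : K * H.card ≤ 2 * N)
    have : 2 * Q * (N / Q) < K * H.card := by
      calc 2 * Q * (N / Q) < K * (N / Q) := by gcongr
        _ ≤ _ := by gcongr
    rw [show 2 * Q * (N / Q) = 2 * N by field_simp] at this
    linarith
  rw [le_div_iff₀ hN0]
  have hbig' : (N : ℝ) ≤ K * J * q := by exact_mod_cast hbig.le
  calc t * N ≤ t * (K * J * q) := by gcongr
    _ = K * (J * t) * q := by ring
    _ ≤ (2 * Q + 1) * (5 * ε) * Q := by gcongr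
    _ = (5 * (2 * Q + 1) * Q) * ε := by ring
    _ ≤ Q ^ 3 * ε := by
      gcongr
      nlinarith [mul_pos hQ0 hQ0]

/-- The multiplier `q` depends on `h`; pigeonholing over its at most `Q` values fixes it to some `r`
on a subset of density `1 / Q ^ 2`, and `linear_recurrence` applies to `r * α`. -/
theorem linear_recurrence_of_approximable {Q α ε : ℝ} {N : ℕ} {H : Finset ℕ} (hQ : 100 ≤ Q)
    (hN : 1 ≤ N) (hH : H ⊆ Finset.Icc 1 N) (hcard : N / Q ≤ H.card) (hε : ε ≤ 1 / Q ^ 4)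
    (hd : ∀ h ∈ H, Approximable (h * α) Q ε) :
    Approximable α (Q ^ 3) (Q ^ 6 * ε / N) := by
  have hQ0 : 0 < Q := by linarith
  choose! q hq1 hqQ hq using hd
  obtain ⟨r, hr, hfib⟩ := Finset.exists_le_card_fiber_of_nsmul_le_card_of_maps_to
    (s := H) (t := Finset.Icc 1 ⌊Q⌋₊) (f := q) (b := (N : ℝ) / Q ^ 2)
    (fun h hh => Finset.mem_Icc.mpr ⟨hq1 h hh, Nat.le_floor (hqQ h hh)⟩)
    ⟨1, Finset.mem_Icc.mpr ⟨le_rfl, Nat.le_floor (by push_cast; linarith)⟩⟩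
    (by
      rw [Nat.card_Icc, Nat.add_sub_cancel, nsmul_eq_mul]
      calc (⌊Q⌋₊ : ℝ) * (N / Q ^ 2) ≤ Q * (N / Q ^ 2) := by
            gcongr; exact Nat.floor_le hQ0.le
        _ = N / Q := by field_simp
        _ ≤ _ := hcard)
  have hr' := Finset.mem_Icc.mp hr
  have hrQ : (r : ℝ) ≤ Q := (Nat.cast_le.mpr hr'.2).trans (Nat.floor_le hQ0.le)
  have := linear_recurrence (Q := Q ^ 2) (α := r * α) (ε := ε)
    (H := H.filter (fun h => q h = r)) (by nlinarith) hN
    ((Finset.filter_subset _ _).trans hH) hfib (by rw [← pow_mul]; exact hε) (by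
      intro h hh
      obtain ⟨hh, hr⟩ := Finset.mem_filter.mp hh
      have := hq h hh
      rwa [hr, mul_left_comm] at this)
  have := this.of_mul hr'.1
  refine this.mono ?_ ?_
  · calc (r : ℝ) * Q ^ 2 ≤ Q * Q ^ 2 := by gcongr
      _ = Q ^ 3 := by ring
  · rw [← pow_mul]

/-! ### Weyl differencing -/

open scoped ComplexConjugate

/-- Expand the square over pairs, fold it onto `n ≤ m` (counting the diagonal twice only helps), and
group by `h = m - n`. -/
theorem norm_sum_range_sq_le (F : ℕ → ℂ) (M : ℕ) :
    ‖∑ n ∈ Finset.range M, F n‖ ^ 2 ≤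
      2 * ∑ h ∈ Finset.range M, ‖∑ n ∈ Finset.range (M - h), F (n + h) * conj (F n)‖ := by
  have key : ∀ M : ℕ, ‖∑ n ∈ Finset.range M, F n‖ ^ 2 ≤
      2 * (∑ m ∈ Finset.range M, ∑ n ∈ Finset.range (m + 1), F m * conj (F n)).re := by
    intro M
    induction M with
    | zero => simp
    | succ M ih =>
      rw [Finset.sum_range_succ, Finset.sum_range_succ _ M, Complex.add_re, ← Finset.mul_sum,
        Finset.sum_range_succ (fun n => conj (F n)) M, ← map_sum]
      set S := ∑ n ∈ Finset.range M, F n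
      rw [← Complex.normSq_eq_norm_sq] at ih ⊢
      simp only [Complex.normSq_apply, Complex.add_re, Complex.add_im, Complex.mul_re,
        Complex.conj_re, Complex.conj_im] at ih ⊢
      nlinarith [sq_nonneg (F M).re, sq_nonneg (F M).im]
  refine (key M).trans ?_
  have := Finset.sum_range_diag_flip M (fun h n => F (n + h) * conj (F n))
  have e : ∀ m ∈ Finset.range M, ∑ n ∈ Finset.range (m + 1), F m * conj (F n) =
      ∑ k ∈ Finset.range (m + 1), F (m - k + k) * conj (F (m - k)) := by
    intro m _
    rw [← Finset.sum_range_reflect]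
    refine Finset.sum_congr rfl fun k hk => ?_
    have := Finset.mem_range.mp hk
    rw [Nat.sub_add_cancel (by omega), show m + 1 - 1 - k = m - k by omega]
  rw [Finset.sum_congr rfl e, this]
  gcongr
  exact (Complex.re_le_norm _).trans (norm_sum_le _ _)

theorem norm_sum_le_card_of_le_one {ι : Type*} {F : ι → ℂ} (hF : ∀ i, ‖F i‖ ≤ 1) (s : Finset ι) :
    ‖∑ i ∈ s, F i‖ ≤ s.card := by
  simpa using (norm_sum_le_of_le s (fun i _ => hF i))

/-- Popularity principle: terms below `c` contribute at most `s.card * c`, so the rest of the sum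
must come from many large terms. -/
theorem card_filter_ge_of_sum_ge {ι : Type*} {s : Finset ι} {f : ι → ℝ} {B c T : ℝ}
    (hB : ∀ i ∈ s, f i ≤ B) (hc : 0 ≤ c) (hT : T ≤ ∑ i ∈ s, f i) :
    T - s.card * c ≤ (s.filter (fun i => c ≤ f i)).card * B := by
  rw [← Finset.sum_filter_add_sum_filter_not s (fun i => c ≤ f i)] at hT
  have h1 : ∑ i ∈ s.filter (fun i => c ≤ f i), f i ≤ (s.filter (fun i => c ≤ f i)).card * B := by
    rw [← nsmul_eq_mul]
    exact Finset.sum_le_card_nsmul _ _ _ (fun i hi => hB i (Finset.mem_filter.mp hi).1)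
  have h2 : ∑ i ∈ s.filter (fun i => ¬ c ≤ f i), f i ≤ s.card * c := by
    calc _ ≤ (s.filter (fun i => ¬ c ≤ f i)).card • c :=
          Finset.sum_le_card_nsmul _ _ _ (fun i hi => (not_le.mp (Finset.mem_filter.mp hi).2).le)
      _ ≤ _ := by
          rw [nsmul_eq_mul]; gcongr; exact Finset.filter_subset _ _
  linarith

/-- Many shifts correlate when an exponential sum is large. -/
theorem card_large_correlation {F : ℕ → ℂ} (hF : ∀ n, ‖F n‖ ≤ 1) {Q : ℝ} (hQ : 100 ≤ Q) {M N : ℕ}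
    (hM : M ≤ N) (hN : Q ^ 3 ≤ N) (hS : N / Q ≤ ‖∑ n ∈ Finset.range M, F n‖) :
    (N : ℝ) / Q ^ 3 ≤ ((Finset.Icc 1 N).filter (fun h =>
      (N : ℝ) / Q ^ 3 ≤ ‖∑ n ∈ Finset.range (M - h), F (n + h) * conj (F n)‖)).card := by
  have hQ0 : 0 < Q := by linarith
  have hN0 : (0 : ℝ) < N := lt_of_lt_of_le (by positivity) hN
  set S : ℕ → ℝ := fun h => ‖∑ n ∈ Finset.range (M - h), F (n + h) * conj (F n)‖ with hSdef
  have hSN : ∀ h, S h ≤ N := by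
    intro h
    refine (norm_sum_le_card_of_le_one (fun n => ?_) _).trans ?_
    · rw [norm_mul, Complex.norm_conj]
      exact mul_le_one₀ (hF _) (norm_nonneg _) (hF _)
    · rw [Finset.card_range]; exact_mod_cast (Nat.sub_le _ _).trans hM
  have h1 := norm_sum_range_sq_le F M
  have h2 : ∑ h ∈ Finset.range M, S h ≤ N + ∑ h ∈ Finset.Icc 1 N, S h := by
    calc ∑ h ∈ Finset.range M, S h ≤ ∑ h ∈ Finset.range (N + 1), S h :=
          Finset.sum_le_sum_of_subset_of_nonneg (Finset.range_mono (by omega))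
            (fun _ _ _ => norm_nonneg _)
      _ = S 0 + ∑ h ∈ Finset.Icc 1 N, S h := by
          rw [Finset.range_eq_Ico, Finset.sum_eq_sum_Ico_succ_bot (by omega)]
          rfl
      _ ≤ _ := by gcongr; exact hSN 0
  have h3 : (N / Q) ^ 2 ≤ ‖∑ n ∈ Finset.range M, F n‖ ^ 2 := by gcongr
  have h4 : (N : ℝ) ^ 2 / (4 * Q ^ 2) ≤ ∑ h ∈ Finset.Icc 1 N, S h := by
    have : (2 : ℝ) * N ≤ N ^ 2 / (2 * Q ^ 2) := by
      rw [le_div_iff₀ (by positivity)]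
      have : 4 * Q ^ 2 ≤ N := le_trans (by nlinarith [sq_nonneg Q]) hN
      nlinarith
    -- Half of the lower bound pays for the trivial shift `h = 0`.
    have e1 : (N / Q) ^ 2 = (N : ℝ) ^ 2 / (2 * Q ^ 2) + 2 * (N ^ 2 / (4 * Q ^ 2)) := by
      field_simp; norm_num
    have h5 : ‖∑ n ∈ Finset.range M, F n‖ ^ 2 ≤ 2 * ∑ h ∈ Finset.range M, S h := h1
    linarith
  have h5 := card_filter_ge_of_sum_ge (c := N / Q ^ 3) (fun h _ => hSN h) (by positivity) h4
  rw [Nat.card_Icc, Nat.add_sub_cancel] at h5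
  have h6 : (N : ℝ) / Q ^ 3 * N ≤ N ^ 2 / (4 * Q ^ 2) - N * (N / Q ^ 3) := by
    rw [show (N : ℝ) ^ 2 / (4 * Q ^ 2) - N * (N / Q ^ 3) = N ^ 2 / Q ^ 3 * (Q / 4 - 1) by
      field_simp, show (N : ℝ) / Q ^ 3 * N = N ^ 2 / Q ^ 3 * 1 by ring]
    gcongr
    linarith
  exact le_of_mul_le_mul_right (h6.trans h5) hN0

/-! ### Weyl sums of degree at most three -/

/-- `e(x) = exp(2πix)`. -/
noncomputable def expo (x : ℝ) : ℂ := (Real.fourierChar x : ℂ)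

theorem expo_eq (x : ℝ) : expo x = Complex.exp (Complex.I * ((2 * Real.pi * x : ℝ) : ℂ)) := by
  rw [expo, Real.fourierChar_apply, mul_comm]

theorem norm_expo (x : ℝ) : ‖expo x‖ = 1 := Circle.norm_coe _

theorem expo_zero : expo 0 = 1 := by simp [expo]

theorem expo_add (x y : ℝ) : expo (x + y) = expo x * expo y := by
  simp [expo_eq, ← Complex.exp_add, mul_add]

theorem conj_expo (x : ℝ) : conj (expo x) = expo (-x) := by
  rw [expo_eq, expo_eq, ← Complex.exp_conj, map_mul, Complex.conj_I, Complex.conj_ofReal]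
  congr 1; push_cast; ring

theorem expo_mul_conj (x y : ℝ) : expo x * conj (expo y) = expo (x - y) := by
  rw [conj_expo, ← expo_add, sub_eq_add_neg]

theorem expo_intCast (a : ℤ) : expo a = 1 := by
  rw [expo_eq, Complex.exp_eq_one_iff]
  exact ⟨a, by push_cast; ring⟩

theorem expo_add_intCast (x : ℝ) (a : ℤ) : expo (x + a) = expo x := by
  rw [expo_add, expo_intCast, mul_one]

theorem expo_natCast_mul (n : ℕ) (x : ℝ) : expo (x * n) = expo x ^ n := by
  rw [expo_eq, expo_eq, ← Complex.exp_nat_mul]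
  congr 1; push_cast; ring

/-- Jordan's inequality for `|e(x) - 1| = 2 |sin πx|`, after reducing `x` modulo `1`. -/
theorem four_mul_distInt_le (x : ℝ) : 4 * distInt x ≤ ‖expo x - 1‖ := by
  have h : expo x = expo (x - round x) := by
    conv_lhs => rw [show x = (x - round x) + round x by ring]
    rw [expo_add_intCast]
  rw [h, expo_eq, Complex.norm_exp_I_mul_ofReal_sub_one, norm_mul, Real.norm_eq_abs,
    Real.norm_eq_abs, abs_two]
  have h1 := abs_sub_round x
  have h2 := Real.mul_abs_le_abs_sin (x := 2 * Real.pi * (x - round x) / 2) (by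
    rw [mul_div_right_comm, mul_div_cancel_left₀ _ two_ne_zero, abs_mul,
      abs_of_pos Real.pi_pos]
    nlinarith [Real.pi_pos])
  rw [mul_div_right_comm, mul_div_cancel_left₀ _ two_ne_zero, abs_mul,
      abs_of_pos Real.pi_pos, ← mul_assoc, div_mul_cancel₀ _ Real.pi_ne_zero] at h2
  rw [mul_div_right_comm, mul_div_cancel_left₀ _ two_ne_zero]
  unfold distInt
  linarith

theorem norm_expo_sub_le (x y : ℝ) : ‖expo x - expo y‖ ≤ 2 * Real.pi * |x - y| := by
  have h : expo x - expo y = expo y * (expo (x - y) - 1) := by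
    rw [mul_sub, ← expo_add]; simp
  rw [h, norm_mul, norm_expo, one_mul, expo_eq, Complex.norm_exp_I_mul_ofReal_sub_one, norm_mul,
    Real.norm_eq_abs, Real.norm_eq_abs, abs_two]
  calc 2 * |Real.sin (2 * Real.pi * (x - y) / 2)| ≤ 2 * |2 * Real.pi * (x - y) / 2| := by
        exact mul_le_mul_of_nonneg_left Real.abs_sin_le_abs zero_le_two
    _ = _ := by
        rw [mul_div_right_comm, mul_div_cancel_left₀ _ two_ne_zero, abs_mul,
          abs_of_pos Real.pi_pos]
        ring

theorem distInt_le_of_linear_sum {α β B : ℝ} {M : ℕ} (hB : 0 < B)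
    (h : B ≤ ‖∑ n ∈ Finset.range M, expo (α * n + β)‖) : distInt α ≤ 1 / B := by
  have h1 : ∑ n ∈ Finset.range M, expo (α * n + β) =
      expo β * ∑ n ∈ Finset.range M, expo α ^ n := by
    rw [Finset.mul_sum]
    refine Finset.sum_congr rfl fun n _ => ?_
    rw [add_comm, expo_add, expo_natCast_mul]
  rw [h1, norm_mul, norm_expo, one_mul] at h
  have h2 : ‖expo α - 1‖ * ‖∑ n ∈ Finset.range M, expo α ^ n‖ ≤ 2 := by
    rw [← norm_mul, mul_comm, geom_sum_mul]
    refine (norm_sub_le _ _).trans ?_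
    rw [norm_pow, norm_expo, one_pow, norm_one]; norm_num
  rw [le_div_iff₀ hB]
  have h3 : (4 * distInt α) * B ≤ ‖expo α - 1‖ * ‖∑ n ∈ Finset.range M, expo α ^ n‖ := by
    gcongr
    exact four_mul_distInt_le α
  nlinarith [distInt_nonneg α]

/-- One differencing by `k` makes the phase linear with slope `2 k α`. Large correlation for many
`k` bounds `‖2 k α‖` by a geometric series, and `linear_recurrence` removes `k`. -/
theorem weyl_quadratic_aux {Q : ℝ} (hQ : 100 ≤ Q) {M N : ℕ} (hN : 1 ≤ N) (hM : M ≤ N)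
    (α β γ : ℝ) (h : N / Q ≤ ‖∑ n ∈ Finset.range M, expo (α * (n : ℝ) ^ 2 + β * n + γ)‖) :
    Approximable α (Q ^ 36) (Q ^ 36 / N ^ 2) := by
  have hQ0 : 0 < Q := by linarith
  have hQ1 : 1 ≤ Q := by linarith
  have hN0 : (0 : ℝ) < N := by exact_mod_cast hN
  -- For short ranges the permitted error is at least `1`, so `q = 1` works.
  rcases lt_or_ge (N : ℝ) (Q ^ 18) with hs | hs
  · apply approximable_of_one_le (one_le_pow₀ hQ1)
    rw [le_div_iff₀ (by positivity), one_mul, show Q ^ 36 = (Q ^ 18) ^ 2 by ring]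
    gcongr
  have h3 := card_large_correlation (F := fun n => expo (α * (n : ℝ) ^ 2 + β * n + γ))
    (fun n => (norm_expo _).le) hQ hM
    (le_trans (pow_le_pow_right₀ hQ1 (by norm_num)) hs) h
  have h4 := linear_recurrence (Q := Q ^ 6) (α := 2 * α) (ε := Q ^ 3 / N)
    (hQ.trans (le_self_pow₀ hQ1 (by norm_num))) hN (Finset.filter_subset _ _)
    (le_trans (by gcongr; norm_num) h3)
    (by
      rw [div_le_div_iff₀ hN0 (by positivity), one_mul]
      calc Q ^ 3 * (Q ^ 6) ^ 2 = Q ^ 15 := by ring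
        _ ≤ Q ^ 18 := pow_le_pow_right₀ hQ1 (by norm_num)
        _ ≤ N := hs)
    (by
      intro k hk
      have hk := (Finset.mem_filter.mp hk).2
      have e : ∀ n : ℕ, expo (α * ((n + k : ℕ) : ℝ) ^ 2 + β * (n + k : ℕ) + γ) *
          conj (expo (α * (n : ℝ) ^ 2 + β * n + γ)) =
          expo ((k * (2 * α)) * n + (α * k ^ 2 + β * k)) := by
        intro n
        rw [expo_mul_conj]; congr 1; push_cast; ring
      simp_rw [e] at hk
      have := distInt_le_of_linear_sum (by positivity) hk
      rwa [one_div_div] at this)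
  have h5 : Approximable α (2 * Q ^ 6) ((Q ^ 6) ^ 3 * (Q ^ 3 / N) / N) := by
    have := Approximable.of_mul (k := 2) (by norm_num) (x := α) (by exact_mod_cast h4)
    exact_mod_cast this
  refine h5.mono ?_ ?_
  · calc 2 * Q ^ 6 ≤ Q * Q ^ 6 := by gcongr; linarith
      _ = Q ^ 7 := by ring
      _ ≤ _ := pow_le_pow_right₀ hQ1 (by norm_num)
  · rw [show (Q ^ 6) ^ 3 * (Q ^ 3 / N) / N = Q ^ 21 / (N : ℝ) ^ 2 by field_simp]
    gcongr ?_ / _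
    exact pow_le_pow_right₀ hQ1 (by norm_num)

theorem weyl_quadratic : ∃ K : ℕ, 1 ≤ K ∧ ∀ {Q : ℝ}, 100 ≤ Q → ∀ {M N : ℕ}, 1 ≤ N → M ≤ N →
    ∀ α β γ : ℝ, N / Q ≤ ‖∑ n ∈ Finset.range M, expo (α * (n : ℝ) ^ 2 + β * n + γ)‖ →
    Approximable α (Q ^ K) (Q ^ K / N ^ 2) :=
  ⟨36, by norm_num, fun hQ _ _ hN hM α β γ h => weyl_quadratic_aux hQ hN hM α β γ h⟩

/-- Differencing by `k` gives a quadratic phase with leading coefficient `3 k α₃`, to which the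
quadratic case applies for many `k`. -/
theorem weyl_cubic_leading : ∃ K : ℕ, 1 ≤ K ∧ ∀ {Q : ℝ}, 100 ≤ Q → ∀ {M N : ℕ}, 1 ≤ N → M ≤ N →
    ∀ α₃ α₂ β γ : ℝ,
    N / Q ≤ ‖∑ n ∈ Finset.range M, expo (α₃ * (n : ℝ) ^ 3 + α₂ * (n : ℝ) ^ 2 + β * n + γ)‖ →
    Approximable α₃ (Q ^ K) (Q ^ K / N ^ 3) := by
  obtain ⟨K, hK, hW⟩ := weyl_quadratic
  refine ⟨(3 * K + 3) * 9, by omega, ?_⟩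
  intro Q hQ M N hN hM α₃ α₂ β γ h
  have hQ0 : 0 < Q := by linarith
  have hQ1 : 1 ≤ Q := by linarith
  have hN0 : (0 : ℝ) < N := by exact_mod_cast hN
  rw [pow_mul]
  -- `R` dominates both the density loss `Q ^ 3` of differencing and the loss `(Q ^ 3) ^ K` of the
  -- quadratic case.
  set R := Q ^ (3 * K + 3) with hR
  have hQ3R : Q ^ 3 ≤ R := pow_le_pow_right₀ hQ1 (by omega)
  have hKR : (Q ^ 3) ^ K ≤ R := by
    rw [← pow_mul]; exact pow_le_pow_right₀ hQ1 (by omega)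
  have hR100 : 100 ≤ R := le_trans (hQ.trans (le_self_pow₀ hQ1 (by norm_num))) hQ3R
  have hR1 : 1 ≤ R := by linarith
  have hR0 : 0 < R := by linarith
  rcases lt_or_ge (N : ℝ) (R ^ 3) with hs | hs
  · apply approximable_of_one_le (one_le_pow₀ hR1)
    rw [le_div_iff₀ (by positivity), one_mul, show R ^ 9 = (R ^ 3) ^ 3 by ring]
    gcongr
  have h3 := card_large_correlation
    (F := fun n => expo (α₃ * (n : ℝ) ^ 3 + α₂ * (n : ℝ) ^ 2 + β * n + γ))
    (fun n => (norm_expo _).le) hQ hM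
    (le_trans (hQ3R.trans (le_self_pow₀ hR1 (by norm_num))) hs) h
  have h4 := linear_recurrence_of_approximable (Q := R) (α := 3 * α₃) (ε := R / (N : ℝ) ^ 2)
    hR100 hN (Finset.filter_subset _ _)
    (le_trans (by gcongr) h3)
    (by
      rw [div_le_div_iff₀ (by positivity) (by positivity), one_mul]
      calc R * R ^ 4 = R ^ 5 := by ring
        _ ≤ R ^ 6 := pow_le_pow_right₀ hR1 (by norm_num)
        _ = (R ^ 3) ^ 2 := by ring
        _ ≤ (N : ℝ) ^ 2 := by gcongr)
    (by
      intro k hk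
      have hk := (Finset.mem_filter.mp hk).2
      have e : ∀ n : ℕ, expo (α₃ * ((n + k : ℕ) : ℝ) ^ 3 + α₂ * ((n + k : ℕ) : ℝ) ^ 2 +
            β * (n + k : ℕ) + γ) *
          conj (expo (α₃ * (n : ℝ) ^ 3 + α₂ * (n : ℝ) ^ 2 + β * n + γ)) =
          expo ((k * (3 * α₃)) * (n : ℝ) ^ 2 + (3 * α₃ * k ^ 2 + 2 * α₂ * k) * n +
            (α₃ * k ^ 3 + α₂ * k ^ 2 + β * k)) := by
        intro n
        rw [expo_mul_conj]; congr 1; push_cast; ring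
      simp_rw [e] at hk
      have := hW (hQ.trans (le_self_pow₀ hQ1 (by norm_num))) hN ((Nat.sub_le M k).trans hM) _ _ _ hk
      exact this.mono hKR (by gcongr))
  have h5 : Approximable α₃ (3 * R ^ 3) (R ^ 6 * (R / (N : ℝ) ^ 2) / N) := by
    have := Approximable.of_mul (k := 3) (by norm_num) (x := α₃) (by exact_mod_cast h4)
    exact_mod_cast this
  refine h5.mono ?_ ?_
  · calc 3 * R ^ 3 ≤ R * R ^ 3 := by gcongr; linarith
      _ = R ^ 4 := by ring
      _ ≤ _ := pow_le_pow_right₀ hR1 (by norm_num)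
  · rw [show R ^ 6 * (R / (N : ℝ) ^ 2) / N = R ^ 7 / (N : ℝ) ^ 3 by field_simp]
    gcongr ?_ / _
    exact pow_le_pow_right₀ hR1 (by norm_num)

/-- Summation by parts against a sequence of bounded variation. -/
theorem norm_sum_mul_le_of_variation {u v : ℕ → ℂ} {A B T : ℝ} (M : ℕ)
    (hu : ∀ m ≤ M, ‖∑ n ∈ Finset.range m, u n‖ ≤ B) (hv : ‖v (M - 1)‖ ≤ A)
    (hT : ∑ n ∈ Finset.range (M - 1), ‖v (n + 1) - v n‖ ≤ T) :
    ‖∑ n ∈ Finset.range M, v n * u n‖ ≤ B * (A + T) := by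
  have hB : 0 ≤ B := (norm_nonneg _).trans (hu 0 (Nat.zero_le _))
  have := Finset.sum_range_by_parts v u M
  simp only [smul_eq_mul] at this
  rw [this]
  calc _ ≤ ‖v (M - 1) * ∑ i ∈ Finset.range M, u i‖ +
        ‖∑ i ∈ Finset.range (M - 1), (v (i + 1) - v i) * ∑ i ∈ Finset.range (i + 1), u i‖ :=
        norm_sub_le _ _
    _ ≤ A * B + ∑ i ∈ Finset.range (M - 1), ‖v (i + 1) - v i‖ * B := by
        gcongr
        · rw [norm_mul]
          exact mul_le_mul hv (hu M le_rfl) (norm_nonneg _) ((norm_nonneg _).trans hv)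
        · refine norm_sum_le_of_le _ fun i hi => ?_
          rw [norm_mul]
          gcongr
          exact hu _ (by have := Finset.mem_range.mp hi; omega)
    _ ≤ _ := by
        rw [← Finset.sum_mul]
        nlinarith

/-! ### Residue classes and the removal of the cubic phase. -/

theorem sum_range_eq_sum_residues {E : Type*} [AddCommMonoid E] (F : ℕ → E) (M : ℕ) {q : ℕ}
    (hq : 1 ≤ q) :
    ∑ n ∈ Finset.range M, F n =
      ∑ r ∈ Finset.range q, ∑ m ∈ Finset.range ((M + q - 1 - r) / q), F (q * m + r) := by
  rw [← Finset.sum_fiberwise_of_maps_to (s := Finset.range M) (t := Finset.range q)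
    (g := fun n => n % q) (fun n _ => Finset.mem_range.mpr (Nat.mod_lt _ hq))]
  refine Finset.sum_congr rfl fun r hr => ?_
  have hr := Finset.mem_range.mp hr
  symm
  -- The upper limit `(M + q - 1 - r) / q` counts exactly the `m` with `q * m + r < M`.
  have hiff : ∀ m, m < (M + q - 1 - r) / q ↔ q * m + r < M := by
    intro m
    rw [Nat.lt_iff_add_one_le, Nat.le_div_iff_mul_le (by omega), add_mul, one_mul, mul_comm m q]
    omega
  refine Finset.sum_bij (fun m _ => q * m + r) ?_ ?_ ?_ ?_
  · intro m hm
    simp only [Finset.mem_filter, Finset.mem_range]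
    refine ⟨(hiff m).mp (Finset.mem_range.mp hm), ?_⟩
    rw [Nat.mul_add_mod, Nat.mod_eq_of_lt hr]
  · intro m _ m' _ h
    exact Nat.eq_of_mul_eq_mul_left hq (by omega)
  · intro n hn
    obtain ⟨h1, h2⟩ := Finset.mem_filter.mp hn
    have h3 := Nat.div_add_mod n q
    rw [h2] at h3
    refine ⟨n / q, Finset.mem_range.mpr ((hiff _).mpr ?_), h3⟩
    rw [h3]; exact Finset.mem_range.mp h1
  · intro m _; rfl

theorem exists_residue_class_sum_ge {F : ℕ → ℂ} {M q : ℕ} (hq : 1 ≤ q) {B : ℝ}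
    (h : q * B ≤ ‖∑ n ∈ Finset.range M, F n‖) :
    ∃ r M' : ℕ, (∀ m < M', q * m + r < M) ∧
      B ≤ ‖∑ m ∈ Finset.range M', F (q * m + r)‖ := by
  rw [sum_range_eq_sum_residues F M hq] at h
  have h2 : ∑ r ∈ Finset.range q, B ≤ ∑ r ∈ Finset.range q,
      ‖∑ m ∈ Finset.range ((M + q - 1 - r) / q), F (q * m + r)‖ := by
    rw [Finset.sum_const, Finset.card_range, nsmul_eq_mul]
    exact h.trans (norm_sum_le _ _)
  obtain ⟨r, hr, hB⟩ := Finset.exists_le_of_sum_le (by simpa using (by omega : q ≠ 0)) h2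
  refine ⟨r, _, fun m hm => ?_, hB⟩
  rw [Nat.lt_iff_add_one_le, Nat.le_div_iff_mul_le (by omega), add_mul, one_mul, mul_comm m q] at hm
  have := Finset.mem_range.mp hr
  omega

/-- A phase that moves monotonically through a total of `R` turns has variation at most `2πR ≤ 7R`,
so partial summation removes it at that cost. -/
theorem norm_sum_monotone_phase_mul_le {u : ℕ → ℂ} {g : ℕ → ℕ} (hg : Monotone g) {θ B R : ℝ}
    (M : ℕ) (hu : ∀ m ≤ M, ‖∑ n ∈ Finset.range m, u n‖ ≤ B) (hR : |θ| * g (M - 1) ≤ R) :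
    ‖∑ n ∈ Finset.range M, expo (θ * g n) * u n‖ ≤ B * (1 + 7 * R) := by
  refine norm_sum_mul_le_of_variation M hu (norm_expo _).le ?_
  calc ∑ n ∈ Finset.range (M - 1), ‖expo (θ * g (n + 1)) - expo (θ * g n)‖
      ≤ ∑ n ∈ Finset.range (M - 1), (2 * Real.pi * |θ|) * ((g (n + 1) : ℝ) - g n) := by
        refine Finset.sum_le_sum fun n _ => ?_
        have h1 : (g n : ℝ) ≤ g (n + 1) := by exact_mod_cast hg n.le_succ
        refine (norm_expo_sub_le _ _).trans (le_of_eq ?_)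
        rw [← mul_sub, abs_mul, abs_of_nonneg (sub_nonneg.mpr h1), mul_assoc (2 * Real.pi)]
    _ = (2 * Real.pi * |θ|) * ((g (M - 1) : ℝ) - g 0) := by
        rw [← Finset.mul_sum, Finset.sum_range_sub (fun n => (g n : ℝ))]
    _ ≤ (2 * Real.pi * |θ|) * (g (M - 1) : ℝ) := by
        gcongr; linarith [Nat.cast_nonneg (α := ℝ) (g 0)]
    _ = 2 * Real.pi * (|θ| * g (M - 1)) := by ring
    _ ≤ 7 * (|θ| * g (M - 1)) := by
        gcongr; linarith [Real.pi_lt_d2]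
    _ ≤ _ := by gcongr

/-- The cubic part of `(qm + r)³` after division by `q`. -/
def cubicIncrement (q r m : ℕ) : ℕ := q ^ 2 * m ^ 3 + 3 * q * m ^ 2 * r + 3 * m * r ^ 2

theorem monotone_cubicIncrement (q r : ℕ) : Monotone (cubicIncrement q r) := by
  intro a b hab
  unfold cubicIncrement
  gcongr

theorem mul_cubicIncrement_le (q r m : ℕ) : q * cubicIncrement q r m ≤ (q * m + r) ^ 3 := by
  have : (q * m + r) ^ 3 = q * cubicIncrement q r m + r ^ 3 := by unfold cubicIncrement; ring
  omega

/-- The cubic part carries the coefficient `q α₃`, which may be replaced by its signed distance to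
the nearest integer because `cubicIncrement` is integral. -/
theorem expo_cubic_residue_class (α₃ α₂ β γ : ℝ) (q r m : ℕ) :
    expo (α₃ * ((q * m + r : ℕ) : ℝ) ^ 3 + α₂ * ((q * m + r : ℕ) : ℝ) ^ 2 +
      β * (q * m + r : ℕ) + γ) =
    expo ((q * α₃ - round (q * α₃)) * cubicIncrement q r m) *
      expo (((q ^ 2 : ℕ) * α₂) * (m : ℝ) ^ 2 + (2 * α₂ * q * r + β * q) * m +
        (α₃ * r ^ 3 + α₂ * r ^ 2 + β * r + γ)) := by
  rw [← expo_add]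
  generalize round (q * α₃) = a
  rw [← expo_add_intCast (_ * (cubicIncrement q r m : ℝ) + _) (a * cubicIncrement q r m)]
  congr 1
  unfold cubicIncrement
  push_cast; ring

/-- Some residue class modulo `q` retains a large sum. There the cubic phase makes at most `R` turns
and is removed by partial summation, leaving a quadratic sum with leading coefficient `q² α₂`. -/
theorem exists_quadratic_sum_ge {Q R : ℝ} (hQ : 100 ≤ Q) (hQR : Q ≤ R) {M N : ℕ} (hN : 1 ≤ N)
    (hM : M ≤ N) (α₃ α₂ β γ : ℝ) {q : ℕ} (hq1 : 1 ≤ q) (hqR : (q : ℝ) ≤ R)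
    (hqα : distInt (q * α₃) ≤ R / (N : ℝ) ^ 3)
    (h : N / Q ≤ ‖∑ n ∈ Finset.range M,
      expo (α₃ * (n : ℝ) ^ 3 + α₂ * (n : ℝ) ^ 2 + β * n + γ)‖) :
    ∃ X ≤ N, ∃ β' γ' : ℝ, (N : ℝ) / R ^ 4 ≤
      ‖∑ m ∈ Finset.range X, expo (((q ^ 2 : ℕ) * α₂) * (m : ℝ) ^ 2 + β' * m + γ')‖ := by
  have hQ0 : 0 < Q := by linarith
  have hR0 : 0 < R := by linarith
  have hN0 : (0 : ℝ) < N := by exact_mod_cast hN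
  obtain ⟨r, M', hM', hB⟩ := exists_residue_class_sum_ge (q := q) (B := N / (Q * R)) hq1
    (le_trans (by
      calc q * (N / (Q * R)) ≤ R * (N / (Q * R)) := by gcongr
        _ = N / Q := by field_simp) h)
  have hM'N : M' ≤ N := by
    rcases Nat.eq_zero_or_pos M' with h0 | h0
    · omega
    · have h1 := hM' (M' - 1) (by omega)
      have h2 : M' - 1 ≤ q * (M' - 1) := Nat.le_mul_of_pos_left _ hq1
      omega
  simp_rw [expo_cubic_residue_class] at hB
  set β' := 2 * α₂ * q * r + β * q
  set γ' := α₃ * r ^ 3 + α₂ * r ^ 2 + β * r + γ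
  have hphase : |q * α₃ - round (q * α₃)| * cubicIncrement q r (M' - 1) ≤ R := by
    have hgN : (cubicIncrement q r (M' - 1) : ℝ) ≤ N ^ 3 := by
      rcases Nat.eq_zero_or_pos M' with hz | hz
      · rw [hz]; simp [cubicIncrement]
      · have h1 : q * (M' - 1) + r ≤ N := (hM' (M' - 1) (by omega)).le.trans hM
        have h2 := Nat.le_mul_of_pos_left (cubicIncrement q r (M' - 1)) hq1
        exact_mod_cast (h2.trans (mul_cubicIncrement_le _ _ _)).trans (Nat.pow_le_pow_left h1 3)
    calc _ ≤ R / (N : ℝ) ^ 3 * (N : ℝ) ^ 3 := mul_le_mul hqα hgN (by positivity) (by positivity)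
      _ = R := by field_simp
  by_contra! hcon
  have h1 := norm_sum_monotone_phase_mul_le (monotone_cubicIncrement q r) M'
    (fun m hm => (hcon m (hm.trans hM'N) β' γ').le) hphase
  have h2 : (N : ℝ) / R ^ 4 * (1 + 7 * R) < N / (Q * R) := by
    rw [div_mul_eq_mul_div, div_lt_div_iff₀ (by positivity) (by positivity), mul_assoc]
    refine mul_lt_mul_of_pos_left ?_ hN0
    calc (1 + 7 * R) * (Q * R) ≤ (8 * R) * (R * R) := by gcongr; linarith
      _ = 8 * R ^ 3 := by ring
      _ < R * R ^ 3 := by gcongr; linarith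
      _ = R ^ 4 := by ring
  exact absurd (hB.trans h1) (not_le.mpr h2)

/-- A large cubic Weyl sum forces simultaneous approximation of the cubic and the quadratic
coefficient, with losses polynomial in the density. -/
theorem weyl_cubic : ∃ K : ℕ, 1 ≤ K ∧ ∀ {Q : ℝ}, 100 ≤ Q → ∀ {M N : ℕ}, 1 ≤ N → M ≤ N →
    ∀ α₃ α₂ β γ : ℝ,
    N / Q ≤ ‖∑ n ∈ Finset.range M, expo (α₃ * (n : ℝ) ^ 3 + α₂ * (n : ℝ) ^ 2 + β * n + γ)‖ →
    ∃ q : ℕ, 1 ≤ q ∧ (q : ℝ) ≤ Q ^ K ∧ distInt (q * α₂) ≤ Q ^ K / N ^ 2 ∧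
      distInt (q * α₃) ≤ Q ^ K / N ^ 3 := by
  obtain ⟨K₁, hK₁, hW₁⟩ := weyl_cubic_leading
  obtain ⟨K₂, hK₂, hW₂⟩ := weyl_quadratic
  refine ⟨K₁ * (4 * K₂ + 3), by nlinarith, ?_⟩
  intro Q hQ M N hN hM α₃ α₂ β γ h
  have hQ1 : 1 ≤ Q := by linarith
  obtain ⟨q, hq1, hqR, hqα⟩ := hW₁ hQ hN hM α₃ α₂ β γ h
  rw [pow_mul]
  have hQR : Q ≤ Q ^ K₁ := le_self_pow₀ hQ1 (by omega)
  generalize Q ^ K₁ = R at *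
  have hR1 : 1 ≤ R := by linarith
  have hR0 : 0 < R := by linarith
  obtain ⟨X, hX, β', γ', hXu⟩ := exists_quadratic_sum_ge hQ hQR hN hM α₃ α₂ β γ hq1 hqR hqα h
  obtain ⟨s, hs1, hsR, hsα⟩ := hW₂ (Q := R ^ 4)
    (le_trans (hQ.trans hQR) (le_self_pow₀ hR1 (by norm_num))) hN hX _ _ _ hXu
  rw [← pow_mul] at hsR hsα
  -- `s` handles `q² α₂`, and `s q² α₃ = (s q)(q α₃)` stays small because `s q` is at most a power
  -- of `R`.
  refine ⟨s * q ^ 2, Nat.mul_pos hs1 (pow_pos hq1 2), ?_, ?_, ?_⟩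
  · push_cast
    calc (s : ℝ) * q ^ 2 ≤ R ^ (4 * K₂) * R ^ 2 := by gcongr
      _ = R ^ (4 * K₂ + 2) := by ring
      _ ≤ _ := pow_le_pow_right₀ hR1 (by omega)
  · rw [Nat.cast_mul, mul_assoc]
    refine hsα.trans ?_
    gcongr ?_ / _
    exact pow_le_pow_right₀ hR1 (by omega)
  · rw [show ((s * q ^ 2 : ℕ) : ℝ) * α₃ = ((s * q : ℕ) : ℝ) * (q * α₃) by push_cast; ring]
    refine (distInt_natCast_mul_le _ _).trans ?_
    push_cast
    calc (s : ℝ) * q * distInt (q * α₃) ≤ R ^ (4 * K₂) * R * (R / (N : ℝ) ^ 3) := by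
          gcongr
          exact distInt_nonneg _
      _ = R ^ (4 * K₂ + 2) / (N : ℝ) ^ 3 := by ring
      _ ≤ _ := by
        gcongr ?_ / _
        exact pow_le_pow_right₀ hR1 (by omega)

/-! ### Recurrence of polynomials of degree at most three -/

/-- `card_large_correlation` applied to the indicator function of `H`: many shifts `h` have many
pairs `n`, `n + h` in `H`. -/
theorem card_large_differences {Q : ℝ} (hQ : 100 ≤ Q) {N : ℕ} {H : Finset ℕ}
    (hH : H ⊆ Finset.range N) (hN : Q ^ 3 ≤ N) (hcard : N / Q ≤ H.card) :
    (N : ℝ) / Q ^ 3 ≤ ((Finset.Icc 1 N).filter (fun h =>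
      (N : ℝ) / Q ^ 3 ≤ (H.filter (fun n => n + h ∈ H)).card)).card := by
  have hs : ∀ s : Finset ℕ, H ⊆ s → (H.card : ℂ) = ∑ n ∈ s, if n ∈ H then (1 : ℂ) else 0 := by
    intro s hs
    rw [Finset.sum_ite_mem, Finset.inter_eq_right.mpr hs]; simp
  have h1 := card_large_correlation (F := fun n => if n ∈ H then (1 : ℂ) else 0)
    (fun n => by split_ifs <;> simp) hQ (le_refl N) hN (by
      rw [← hs _ hH, Complex.norm_natCast]; exact hcard)
  refine h1.trans ?_
  gcongr with h hh
  have : ∑ n ∈ Finset.range (N - h), (if n + h ∈ H then (1 : ℂ) else 0) *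
      conj (if n ∈ H then (1 : ℂ) else 0) =
      (((Finset.range (N - h)).filter (fun n => n ∈ H ∧ n + h ∈ H)).card : ℂ) := by
    rw [Finset.card_filter, Nat.cast_sum]
    refine Finset.sum_congr rfl fun n _ => ?_
    by_cases h1 : n ∈ H <;> by_cases h2 : n + h ∈ H <;> simp [h1, h2]
  rw [this, Complex.norm_natCast]
  gcongr
  intro n hn
  simp only [Finset.mem_filter] at hn ⊢
  exact hn.2

theorem recurrence_linear {Q : ℝ} (hQ : 100 ≤ Q) {N : ℕ} {H : Finset ℕ}
    (hH : H ⊆ Finset.range N) (hN : Q ^ 3 ≤ N) (hcard : N / Q ≤ H.card) {α β ε : ℝ}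
    (hε : ε ≤ 1 / Q ^ 7) (hd : ∀ n ∈ H, distInt (α * n + β) ≤ ε) :
    Approximable α (Q ^ 10) (Q ^ 10 * ε / N) := by
  have hQ0 : 0 < Q := by linarith
  have hQ1 : 1 ≤ Q := by linarith
  have hN0 : (0 : ℝ) < N := lt_of_lt_of_le (by positivity) hN
  have hne : H.Nonempty := by
    rw [← Finset.card_pos]
    have : (0 : ℝ) < H.card := lt_of_lt_of_le (by positivity) hcard
    exact_mod_cast this
  have hε0 : 0 ≤ ε := by
    obtain ⟨n, hn⟩ := hne
    exact (distInt_nonneg _).trans (hd n hn)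
  have h1 := card_large_differences hQ hH hN hcard
  have h2 := linear_recurrence (Q := Q ^ 3) (α := α) (ε := 2 * ε)
    (hQ.trans (le_self_pow₀ hQ1 (by norm_num))) (by exact_mod_cast hN0)
    (Finset.filter_subset _ _) h1
    (by
      rw [le_div_iff₀ (by positivity)] at hε ⊢
      calc 2 * ε * (Q ^ 3) ^ 2 = ε * (2 * Q ^ 6) := by ring
        _ ≤ ε * (Q * Q ^ 6) := by gcongr; linarith
        _ = ε * Q ^ 7 := by ring
        _ ≤ 1 := hε)
    (by
      intro h hh
      have hh := (Finset.mem_filter.mp hh).2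
      have hpos : (0 : ℝ) < (H.filter (fun n => n + h ∈ H)).card :=
        lt_of_lt_of_le (by positivity) hh
      obtain ⟨n, hn⟩ := Finset.card_pos.mp (by exact_mod_cast hpos)
      obtain ⟨hn1, hn2⟩ := Finset.mem_filter.mp hn
      have e : (h : ℝ) * α = (α * (n + h : ℕ) + β) - (α * n + β) := by push_cast; ring
      rw [e]
      linarith [distInt_sub_le (α * (n + h : ℕ) + β) (α * n + β), hd _ hn1, hd _ hn2])
  refine h2.mono (pow_le_pow_right₀ hQ1 (by norm_num)) ?_
  gcongr ?_ / _
  calc (Q ^ 3) ^ 3 * (2 * ε) = (2 * Q ^ 9) * ε := by ring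
    _ ≤ (Q * Q ^ 9) * ε := by gcongr; linarith
    _ = Q ^ 10 * ε := by ring

/-- The step from degree `d` to degree `d + 1` in the recurrence lemma. -/
theorem recurrence_step {K d c : ℕ} (hc : 1 ≤ c) (hc3 : c ≤ 3) {p : ℕ → ℝ}
    {α : ℝ} {Q : ℝ} (hQ : 100 ≤ Q) {N : ℕ} {H : Finset ℕ}
    (hH : H ⊆ Finset.range N) (hN : Q ^ (8 * (3 * K + 3)) ≤ N) (hcard : N / Q ≤ H.card) {ε : ℝ}
    (hε : ε ≤ 1 / Q ^ (8 * (3 * K + 3))) (hd : ∀ n ∈ H, distInt (p n) ≤ ε)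
    (hrec : ∀ h : ℕ, ∀ H' : Finset ℕ, H' ⊆ Finset.range N → N / Q ^ 3 ≤ (H'.card : ℝ) →
      (∀ n ∈ H', distInt (p (n + h) - p n) ≤ 2 * ε) →
      Approximable (h * (c * α)) ((Q ^ 3) ^ K) ((Q ^ 3) ^ K * (2 * ε) / N ^ d)) :
    Approximable α (Q ^ (8 * (3 * K + 3))) (Q ^ (8 * (3 * K + 3)) * ε / N ^ (d + 1)) := by
  have hQ0 : 0 < Q := by linarith
  have hQ1 : 1 ≤ Q := by linarith
  have hN0 : (0 : ℝ) < N := lt_of_lt_of_le (by positivity) hN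
  have hN1 : 1 ≤ N := by exact_mod_cast hN0
  have hN1' : (1 : ℝ) ≤ N := by exact_mod_cast hN1
  have hne : H.Nonempty := by
    rw [← Finset.card_pos]
    have : (0 : ℝ) < H.card := lt_of_lt_of_le (by positivity) hcard
    exact_mod_cast this
  have hε0 : 0 ≤ ε := by
    obtain ⟨n, hn⟩ := hne
    exact (distInt_nonneg _).trans (hd n hn)
  have h1 := card_large_differences hQ hH
    ((pow_le_pow_right₀ hQ1 (by omega)).trans hN) hcard
  have hc0 : (c : ℝ) ≤ 3 := by exact_mod_cast hc3
  rw [mul_comm 8, pow_mul] at hε ⊢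
  have hQR : Q ^ 3 ≤ Q ^ (3 * K + 3) := pow_le_pow_right₀ hQ1 (by omega)
  have hKR : (Q ^ 3) ^ K ≤ Q ^ (3 * K + 3) := by
    rw [← pow_mul]; exact pow_le_pow_right₀ hQ1 (by omega)
  have h2KR : (Q ^ 3) ^ K * (2 * ε) ≤ Q ^ (3 * K + 3) * ε := by
    calc (Q ^ 3) ^ K * (2 * ε) = (Q ^ (3 * K) * 2) * ε := by rw [← pow_mul]; ring
      _ ≤ (Q ^ (3 * K) * Q ^ 3) * ε := by
        gcongr
        exact le_trans (by linarith) (le_self_pow₀ hQ1 (by norm_num : 3 ≠ 0))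
      _ = _ := by rw [← pow_add]
  have hQ100 : 100 ≤ Q ^ (3 * K + 3) :=
    hQ.trans ((le_self_pow₀ hQ1 (by norm_num : 3 ≠ 0)).trans hQR)
  generalize Q ^ (3 * K + 3) = R at *
  have hR1 : 1 ≤ R := by linarith
  have hR0 : 0 < R := by linarith
  -- The differences `p (n + h) - p n` are `2ε`-close to integers on a dense set for many `h`, so
  -- the degree `d` case controls `h * (c * α)`; it remains to remove `h` and then `c`.
  have h2 := linear_recurrence_of_approximable (Q := R) (α := c * α) (ε := R * ε / N ^ d)
    hQ100 hN1 (Finset.filter_subset _ _) (le_trans (by gcongr) h1)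
    (by
      calc R * ε / N ^ d ≤ R * ε := div_le_self (by positivity) (one_le_pow₀ hN1')
        _ ≤ R * (1 / R ^ 8) := by gcongr
        _ = 1 / R ^ 7 := by field_simp
        _ ≤ 1 / R ^ 4 := one_div_le_one_div_of_le (by positivity)
            (pow_le_pow_right₀ hR1 (by norm_num)))
    (by
      intro h hh
      have hh := (Finset.mem_filter.mp hh).2
      refine (hrec h _ ((Finset.filter_subset _ _).trans hH) hh ?_).mono hKR (by gcongr)
      intro n hn
      obtain ⟨hn1, hn2⟩ := Finset.mem_filter.mp hn
      linarith [distInt_sub_le (p (n + h)) (p n), hd _ hn1, hd _ hn2])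
  refine (h2.of_mul hc).mono ?_ ?_
  · calc (c : ℝ) * R ^ 3 ≤ R * R ^ 3 := by gcongr; linarith
      _ = R ^ 4 := by ring
      _ ≤ _ := pow_le_pow_right₀ hR1 (by norm_num)
  · calc R ^ 6 * (R * ε / N ^ d) / N = R ^ 7 * ε / N ^ (d + 1) := by
          rw [pow_succ (N : ℝ)]; field_simp
      _ ≤ _ := by
        gcongr ?_ * _ / _
        exact pow_le_pow_right₀ hR1 (by norm_num)

theorem recurrence_quadratic : ∃ K : ℕ, 1 ≤ K ∧ ∀ {Q : ℝ}, 100 ≤ Q → ∀ {N : ℕ} {H : Finset ℕ},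
    H ⊆ Finset.range N → Q ^ K ≤ N → N / Q ≤ H.card → ∀ {α β γ ε : ℝ}, ε ≤ 1 / Q ^ K →
    (∀ n ∈ H, distInt (α * (n : ℝ) ^ 2 + β * n + γ) ≤ ε) →
    Approximable α (Q ^ K) (Q ^ K * ε / N ^ 2) := by
  refine ⟨8 * (3 * 10 + 3), by norm_num, ?_⟩
  intro Q hQ N H hH hN hcard α β γ ε hε hd
  have hQ0 : 0 < Q := by linarith
  have hQ1 : 1 ≤ Q := by linarith
  refine recurrence_step (d := 1) (c := 2) (p := fun n => α * (n : ℝ) ^ 2 + β * n + γ)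
    (by norm_num) (by norm_num) hQ hH hN hcard hε hd ?_
  intro h H' hH' hcard' hd'
  rw [pow_one]
  refine recurrence_linear (β := α * h ^ 2 + β * h)
    (hQ.trans (le_self_pow₀ hQ1 (by norm_num))) hH' ?_ hcard' ?_ ?_
  · rw [← pow_mul]
    exact (pow_le_pow_right₀ hQ1 (by norm_num)).trans hN
  · rw [le_div_iff₀ (by positivity)] at hε ⊢
    rcases le_or_gt ε 0 with h0 | h0
    · nlinarith [pow_pos (pow_pos hQ0 3) 7]
    · calc 2 * ε * (Q ^ 3) ^ 7 ≤ Q * ε * (Q ^ 3) ^ 7 := by gcongr; linarith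
        _ = ε * Q ^ 22 := by ring
        _ ≤ ε * Q ^ (8 * (3 * 10 + 3)) := by
          gcongr ε * ?_
          exact pow_le_pow_right₀ hQ1 (by norm_num)
        _ ≤ 1 := hε
  · intro n hn
    have := hd' n hn
    convert this using 2
    push_cast; ring

theorem recurrence_cubic : ∃ K : ℕ, 1 ≤ K ∧ ∀ {Q : ℝ}, 100 ≤ Q → ∀ {N : ℕ} {H : Finset ℕ},
    H ⊆ Finset.range N → Q ^ K ≤ N → N / Q ≤ H.card → ∀ {α₃ α₂ β γ ε : ℝ}, ε ≤ 1 / Q ^ K →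
    (∀ n ∈ H, distInt (α₃ * (n : ℝ) ^ 3 + α₂ * (n : ℝ) ^ 2 + β * n + γ) ≤ ε) →
    Approximable α₃ (Q ^ K) (Q ^ K * ε / N ^ 3) := by
  obtain ⟨K, hK, hrec⟩ := recurrence_quadratic
  refine ⟨8 * (3 * K + 3), by omega, ?_⟩
  intro Q hQ N H hH hN hcard α₃ α₂ β γ ε hε hd
  have hQ0 : 0 < Q := by linarith
  have hQ1 : 1 ≤ Q := by linarith
  refine recurrence_step (d := 2) (c := 3)
    (p := fun n => α₃ * (n : ℝ) ^ 3 + α₂ * (n : ℝ) ^ 2 + β * n + γ)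
    (by norm_num) (by norm_num) hQ hH hN hcard hε hd ?_
  intro h H' hH' hcard' hd'
  refine hrec (β := 3 * α₃ * h ^ 2 + 2 * α₂ * h) (γ := α₃ * h ^ 3 + α₂ * h ^ 2 + β * h)
    (hQ.trans (le_self_pow₀ hQ1 (by norm_num))) hH' ?_ hcard' ?_ ?_
  · rw [← pow_mul]
    exact (pow_le_pow_right₀ hQ1 (by omega)).trans hN
  · rw [le_div_iff₀ (by positivity)] at hε ⊢
    rcases le_or_gt ε 0 with h0 | h0
    · nlinarith [pow_pos (pow_pos hQ0 3) K]
    · calc 2 * ε * (Q ^ 3) ^ K ≤ Q * ε * (Q ^ 3) ^ K := by gcongr; linarith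
        _ = ε * Q ^ (3 * K + 1) := by rw [← pow_mul]; ring
        _ ≤ ε * Q ^ (8 * (3 * K + 3)) := by
          gcongr ε * ?_
          exact pow_le_pow_right₀ hQ1 (by omega)
        _ ≤ 1 := hε
  · intro n hn
    have := hd' n hn
    convert this using 2
    push_cast; ring

/-! ### Vaughan's identity -/

open scoped ArithmeticFunction.Moebius

theorem sum_Icc_sum_divisorsAntidiagonal {E : Type*} [AddCommMonoid E] (f : ℕ → ℕ → E) (X : ℕ) :
    ∑ n ∈ Finset.Icc 1 X, ∑ x ∈ n.divisorsAntidiagonal, f x.1 x.2 =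
      ∑ b ∈ Finset.Icc 1 X, ∑ k ∈ Finset.Icc 1 (X / b), f b k := by
  rw [Finset.sum_sigma', Finset.sum_sigma']
  refine Finset.sum_bij' (fun p _ => ⟨p.2.1, p.2.2⟩) (fun p _ => ⟨p.1 * p.2, (p.1, p.2)⟩)
    ?_ ?_ ?_ ?_ ?_
  · rintro ⟨n, b, k⟩ h
    simp only [Finset.mem_sigma, Finset.mem_Icc, Nat.mem_divisorsAntidiagonal] at h ⊢
    obtain ⟨⟨h1, h2⟩, rfl, h3⟩ := h
    have hb : 0 < b := Nat.pos_of_ne_zero fun h => by simp [h] at h3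
    have hk : 0 < k := Nat.pos_of_ne_zero fun h => by simp [h] at h3
    refine ⟨⟨hb, le_trans (Nat.le_mul_of_pos_right _ hk) h2⟩, hk, ?_⟩
    rw [Nat.le_div_iff_mul_le hb, mul_comm]; exact h2
  · rintro ⟨b, k⟩ h
    simp only [Finset.mem_sigma, Finset.mem_Icc, Nat.mem_divisorsAntidiagonal] at h ⊢
    obtain ⟨⟨h1, h2⟩, h3, h4⟩ := h
    rw [Nat.le_div_iff_mul_le (by omega), mul_comm] at h4
    have : 0 < b * k := Nat.mul_pos h1 h3
    exact ⟨⟨this, h4⟩, trivial, this.ne'⟩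
  · rintro ⟨n, b, k⟩ h
    simp only [Finset.mem_sigma, Nat.mem_divisorsAntidiagonal] at h
    obtain ⟨_, rfl, _⟩ := h
    rfl
  · rintro ⟨b, k⟩ _
    rfl
  · rintro ⟨n, b, k⟩ _
    rfl

/-- The part of `∑_{c ∣ k} Λ(c) = log k` coming from the divisors `c > V`. -/
noncomputable def largeLog (V k : ℕ) : ℝ := ∑ c ∈ k.divisors, if V < c then Λ c else 0

theorem largeLog_nonneg (V k : ℕ) : 0 ≤ largeLog V k :=
  Finset.sum_nonneg fun c _ => by
    split_ifs
    · exact ArithmeticFunction.vonMangoldt_nonneg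
    · exact le_rfl

theorem largeLog_le_log (V k : ℕ) : largeLog V k ≤ Real.log k := by
  rw [← ArithmeticFunction.vonMangoldt_sum]
  refine Finset.sum_le_sum fun c _ => ?_
  split_ifs
  · exact le_rfl
  · exact ArithmeticFunction.vonMangoldt_nonneg

theorem largeLog_eq_zero {V k : ℕ} (h : k ≤ V) : largeLog V k = 0 := by
  refine Finset.sum_eq_zero fun c hc => if_neg ?_
  have := Nat.divisor_le hc
  omega

theorem largeLog_eq_log_sub (V k : ℕ) :
    largeLog V k = Real.log k - ∑ c ∈ k.divisors, if c ≤ V then Λ c else 0 := by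
  rw [← ArithmeticFunction.vonMangoldt_sum, ← Finset.sum_sub_distrib]
  refine Finset.sum_congr rfl fun c _ => ?_
  by_cases h : c ≤ V
  · simp [h, not_lt.mpr h]
  · simp [h, not_le.mp h]

/-- Möbius inversion of the definition of `largeLog`. -/
theorem vonMangoldt_large_eq (V : ℕ) {n : ℕ} (hn : 0 < n) :
    ∑ x ∈ n.divisorsAntidiagonal, (μ x.1 : ℝ) * largeLog V x.2 = if V < n then Λ n else 0 :=
  (ArithmeticFunction.sum_eq_iff_sum_mul_moebius_eq
    (f := fun n => if V < n then Λ n else 0) (g := largeLog V)).mp (fun _ _ => rfl) n hn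

theorem vonMangoldt_le_log_of_le {n X : ℕ} (hn : 1 ≤ n) (h : n ≤ X) : Λ n ≤ Real.log X :=
  ArithmeticFunction.vonMangoldt_le_log.trans
    (Real.log_le_log (by exact_mod_cast hn) (by exact_mod_cast h))

theorem norm_small_vonMangoldt_sum_le {F : ℕ → ℂ} (hF : ∀ n, ‖F n‖ ≤ 1) (V X : ℕ) :
    ‖∑ n ∈ Finset.Icc 1 X, ((if n ≤ V then Λ n else 0 : ℝ) : ℂ) * F n‖ ≤ V * Real.log X := by
  have hX : 0 ≤ Real.log X := Real.log_natCast_nonneg X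
  calc _ ≤ ∑ n ∈ Finset.Icc 1 X, if n ≤ V then Real.log X else 0 := by
        refine norm_sum_le_of_le _ fun n hn => ?_
        obtain ⟨h1, h2⟩ := Finset.mem_Icc.mp hn
        split_ifs
        · rw [norm_mul, Complex.norm_real, Real.norm_eq_abs,
            abs_of_nonneg ArithmeticFunction.vonMangoldt_nonneg, ← mul_one (Real.log X)]
          exact mul_le_mul (vonMangoldt_le_log_of_le h1 h2) (hF n) (norm_nonneg _) hX
        · simp
    _ = ((Finset.Icc 1 X).filter (fun n => n ≤ V)).card * Real.log X := by
        rw [← Finset.sum_filter, Finset.sum_const, nsmul_eq_mul]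
    _ ≤ ((Finset.Icc 1 V).card : ℕ) * Real.log X := by
        gcongr
        intro n hn
        simp only [Finset.mem_filter, Finset.mem_Icc] at hn ⊢
        omega
    _ = _ := by rw [Nat.card_Icc, Nat.add_sub_cancel]

theorem norm_log_sum_le {G : ℕ → ℂ} {B : ℝ} (Y : ℕ)
    (hG : ∀ Z ≤ Y, ‖∑ k ∈ Finset.Icc 1 Z, G k‖ ≤ B) :
    ‖∑ k ∈ Finset.Icc 1 Y, (Real.log k : ℂ) * G k‖ ≤ B * (2 * Real.log Y) := by
  have hshift : ∀ (f : ℕ → ℂ) (Z : ℕ), ∑ k ∈ Finset.Icc 1 Z, f k =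
      ∑ m ∈ Finset.range Z, f (m + 1) := by
    intro f Z
    rw [Finset.range_eq_Ico, Finset.sum_Ico_add' f 0 Z 1]
    rfl
  rcases Nat.eq_zero_or_pos Y with rfl | hY
  · simp
  rw [hshift, two_mul]
  refine norm_sum_mul_le_of_variation (u := fun m => G (m + 1))
    (v := fun m => (Real.log ((m + 1 : ℕ) : ℝ) : ℂ)) Y
    (fun m hm => by rw [← hshift]; exact hG m hm) ?_ ?_
  · rw [Complex.norm_real, Nat.sub_add_cancel hY, Real.norm_eq_abs,
      abs_of_nonneg (Real.log_natCast_nonneg _)]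
  · have h1 : ∀ n ∈ Finset.range (Y - 1),
        ‖(Real.log ((n + 1 + 1 : ℕ) : ℝ) : ℂ) - (Real.log ((n + 1 : ℕ) : ℝ) : ℂ)‖ =
        Real.log ((n + 1 + 1 : ℕ) : ℝ) - Real.log ((n + 1 : ℕ) : ℝ) := by
      intro n _
      rw [← Complex.ofReal_sub, Complex.norm_real, Real.norm_eq_abs, abs_of_nonneg]
      rw [sub_nonneg]
      exact Real.log_le_log (by positivity) (by exact_mod_cast (Nat.le_succ _))
    rw [Finset.sum_congr rfl h1, Finset.sum_range_sub (fun n => Real.log ((n + 1 : ℕ) : ℝ)),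
      Nat.sub_add_cancel hY]
    simp

/-- Write `largeLog` as `log` minus its divisors `c ≤ V`: the smooth weight `log` is removed by
partial summation, and each `c` leaves an unweighted sum over multiples of `c`. -/
theorem norm_largeLog_sum_le {G : ℕ → ℂ} {B : ℝ} {V X Y : ℕ} (hV : 1 ≤ V) (hYX : Y ≤ X)
    (hG : ∀ c, 1 ≤ c → c ≤ V → ∀ Z ≤ Y, ‖∑ l ∈ Finset.Icc 1 Z, G (c * l)‖ ≤ B) :
    ‖∑ k ∈ Finset.Icc 1 Y, (largeLog V k : ℂ) * G k‖ ≤ 3 * V * Real.log X * B := by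
  have hB : 0 ≤ B := (norm_nonneg _).trans (hG 1 le_rfl hV 0 (Nat.zero_le _))
  have hlogX := Real.log_natCast_nonneg X
  have hV1 : (1 : ℝ) ≤ V := by exact_mod_cast hV
  have hYX' : Real.log Y ≤ Real.log X := by
    rcases Nat.eq_zero_or_pos Y with rfl | hY
    · simpa using hlogX
    · exact Real.log_le_log (by exact_mod_cast hY) (by exact_mod_cast hYX)
  have h1 := norm_log_sum_le (G := G) Y (fun Z hZ => by simpa using hG 1 le_rfl hV Z hZ)
  have h2 : ∑ k ∈ Finset.Icc 1 Y,
      ((∑ c ∈ k.divisors, if c ≤ V then Λ c else 0 : ℝ) : ℂ) * G k =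
      ∑ c ∈ Finset.Icc 1 Y, ((if c ≤ V then Λ c else 0 : ℝ) : ℂ) *
        ∑ l ∈ Finset.Icc 1 (Y / c), G (c * l) := by
    simp_rw [Finset.mul_sum]
    rw [← sum_Icc_sum_divisorsAntidiagonal
      (fun c l => ((if c ≤ V then Λ c else 0 : ℝ) : ℂ) * G (c * l)) Y]
    refine Finset.sum_congr rfl fun k _ => ?_
    rw [Complex.ofReal_sum, Finset.sum_mul]
    rw [Nat.sum_divisorsAntidiagonal
      (f := fun c l => ((if c ≤ V then Λ c else 0 : ℝ) : ℂ) * G (c * l))]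
    refine Finset.sum_congr rfl fun c hc => ?_
    rw [Nat.mul_div_cancel' (Nat.dvd_of_mem_divisors hc)]
  have h3 : ‖∑ c ∈ Finset.Icc 1 Y, ((if c ≤ V then Λ c else 0 : ℝ) : ℂ) *
        ∑ l ∈ Finset.Icc 1 (Y / c), G (c * l)‖ ≤ V * Real.log X * B := by
    calc _ ≤ ∑ c ∈ Finset.Icc 1 Y, if c ≤ V then Real.log X * B else 0 := by
          refine norm_sum_le_of_le _ fun c hc => ?_
          obtain ⟨hc1, hc2⟩ := Finset.mem_Icc.mp hc
          split_ifs with hcV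
          · rw [norm_mul, Complex.norm_real, Real.norm_eq_abs,
              abs_of_nonneg ArithmeticFunction.vonMangoldt_nonneg]
            exact mul_le_mul (vonMangoldt_le_log_of_le hc1 (hc2.trans hYX))
              (hG c hc1 hcV _ (Nat.div_le_self _ _)) (norm_nonneg _) hlogX
          · simp
      _ = ((Finset.Icc 1 Y).filter (fun n => n ≤ V)).card * (Real.log X * B) := by
          rw [← Finset.sum_filter, Finset.sum_const, nsmul_eq_mul]
      _ ≤ ((Finset.Icc 1 V).card : ℕ) * (Real.log X * B) := by
          gcongr
          intro n hn
          simp only [Finset.mem_filter, Finset.mem_Icc] at hn ⊢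
          omega
      _ = _ := by rw [Nat.card_Icc, Nat.add_sub_cancel, mul_assoc]
  have h4 : ∑ k ∈ Finset.Icc 1 Y, (largeLog V k : ℂ) * G k =
      ∑ k ∈ Finset.Icc 1 Y, (Real.log k : ℂ) * G k - ∑ k ∈ Finset.Icc 1 Y,
      ((∑ c ∈ k.divisors, if c ≤ V then Λ c else 0 : ℝ) : ℂ) * G k := by
    rw [← Finset.sum_sub_distrib]
    refine Finset.sum_congr rfl fun k _ => ?_
    rw [largeLog_eq_log_sub, Complex.ofReal_sub, sub_mul]
  rw [h4, h2]
  refine (norm_sub_le _ _).trans ?_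
  have h5 : B * (2 * Real.log Y) ≤ 2 * V * Real.log X * B := by
    calc B * (2 * Real.log Y) ≤ B * (2 * (V * Real.log X)) := by
          gcongr; nlinarith
      _ = _ := by ring
  linarith

theorem sum_Ioc_le_of_dyadic {a : ℕ → ℝ} (ha : ∀ n, 0 ≤ a n) {U : ℕ} (hU : 1 ≤ U) (X : ℕ) {B : ℝ}
    (hB : ∀ M, U ≤ M → ∑ b ∈ Finset.Ioc M (2 * M), a b ≤ B) :
    ∑ b ∈ Finset.Ioc U X, a b ≤ (Nat.log 2 X + 1) * B := by
  have key : ∀ j : ℕ, ∑ b ∈ Finset.Ioc U (2 ^ j * U), a b ≤ j * B := by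
    intro j
    induction j with
    | zero => simp
    | succ j ih =>
      have h1 : U ≤ 2 ^ j * U := Nat.le_mul_of_pos_left _ (by positivity)
      rw [show 2 ^ (j + 1) * U = 2 * (2 ^ j * U) by ring,
        ← Finset.sum_Ioc_consecutive a h1 (by omega)]
      push_cast
      linarith [hB (2 ^ j * U) h1]
  have hX : X ≤ 2 ^ (Nat.log 2 X + 1) * U :=
    (Nat.lt_pow_succ_log_self one_lt_two X).le.trans (Nat.le_mul_of_pos_right _ hU)
  calc ∑ b ∈ Finset.Ioc U X, a b ≤ ∑ b ∈ Finset.Ioc U (2 ^ (Nat.log 2 X + 1) * U), a b :=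
        Finset.sum_le_sum_of_subset_of_nonneg (Finset.Ioc_subset_Ioc_right hX)
          (fun b _ _ => ha b)
    _ ≤ _ := by simpa using key (Nat.log 2 X + 1)

theorem norm_moebius_le_one (n : ℕ) : ‖(μ n : ℂ)‖ ≤ 1 := by
  rw [Complex.norm_intCast]
  exact_mod_cast ArithmeticFunction.abs_moebius_le_one

/-- Vaughan's decomposition of a sum over `Λ`, as an upper bound in terms of the sums of the first
and second type. -/
theorem norm_vonMangoldt_sum_le {F : ℕ → ℂ} (hF : ∀ n, ‖F n‖ ≤ 1) {V X : ℕ} (hV : 1 ≤ V)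
    {B₁ B₂ : ℝ}
    (h₁ : ∀ d, 1 ≤ d → d ≤ V * V → ∀ Z ≤ X, ‖∑ l ∈ Finset.Icc 1 Z, F (d * l)‖ ≤ B₁)
    (h₂ : ∀ M, V ≤ M → ∑ b ∈ Finset.Ioc M (2 * M),
      ‖∑ k ∈ Finset.Icc 1 (X / b), (largeLog V k : ℂ) * F (b * k)‖ ≤ B₂) :
    ‖∑ n ∈ Finset.Icc 1 X, (Λ n : ℂ) * F n‖ ≤
      V * Real.log X + V * (3 * V * Real.log X * B₁) + (Nat.log 2 X + 1) * B₂ := by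
  set a : ℕ → ℝ := fun b => ‖∑ k ∈ Finset.Icc 1 (X / b), (largeLog V k : ℂ) * F (b * k)‖ with ha
  have hB₁ : 0 ≤ B₁ := (norm_nonneg _).trans (h₁ 1 le_rfl (Nat.mul_pos hV hV) 0 (Nat.zero_le _))
  have hlogX := Real.log_natCast_nonneg X
  -- Below, `b ≤ V` combines with `c ≤ V` into moduli `d = b * c ≤ V * V`, while `b > V` is left to
  -- the dyadic bilinear bound.
  have hsplit : ∑ n ∈ Finset.Icc 1 X, (Λ n : ℂ) * F n =
      ∑ n ∈ Finset.Icc 1 X, ((if n ≤ V then Λ n else 0 : ℝ) : ℂ) * F n +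
      ∑ b ∈ Finset.Icc 1 X, (μ b : ℂ) *
        ∑ k ∈ Finset.Icc 1 (X / b), (largeLog V k : ℂ) * F (b * k) := by
    simp_rw [Finset.mul_sum]
    rw [← sum_Icc_sum_divisorsAntidiagonal
      (fun b k => (μ b : ℂ) * ((largeLog V k : ℂ) * F (b * k))) X, ← Finset.sum_add_distrib]
    refine Finset.sum_congr rfl fun n hn => ?_
    have h := vonMangoldt_large_eq V (n := n) (Finset.mem_Icc.mp hn).1
    have e : ∑ x ∈ n.divisorsAntidiagonal,
        (μ x.1 : ℂ) * ((largeLog V x.2 : ℂ) * F (x.1 * x.2)) =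
        ((if V < n then Λ n else 0 : ℝ) : ℂ) * F n := by
      rw [← h, Complex.ofReal_sum, Finset.sum_mul]
      refine Finset.sum_congr rfl fun x hx => ?_
      rw [(Nat.mem_divisorsAntidiagonal.mp hx).1]
      push_cast; ring
    rw [e, ← add_mul, ← Complex.ofReal_add]
    by_cases hnV : n ≤ V
    · simp [hnV, not_lt.mpr hnV]
    · simp [hnV, not_le.mp hnV]
  have hI : ∀ b ∈ Finset.Icc 1 V, a b ≤ 3 * V * Real.log X * B₁ := by
    intro b hb
    obtain ⟨hb1, hb2⟩ := Finset.mem_Icc.mp hb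
    refine norm_largeLog_sum_le (G := fun k => F (b * k)) hV (Nat.div_le_self X b) ?_
    intro c hc1 hc2 Z hZ
    have := h₁ (b * c) (Nat.mul_pos hb1 hc1) (Nat.mul_le_mul hb2 hc2) Z
      (hZ.trans (Nat.div_le_self X b))
    simpa [mul_assoc] using this
  have hsum : ∑ b ∈ Finset.Icc 1 X, a b ≤
      V * (3 * V * Real.log X * B₁) + (Nat.log 2 X + 1) * B₂ := by
    calc ∑ b ∈ Finset.Icc 1 X, a b ≤
          ∑ b ∈ Finset.Icc 1 V ∪ Finset.Ioc V X, a b := by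
          refine Finset.sum_le_sum_of_subset_of_nonneg ?_ (fun _ _ _ => norm_nonneg _)
          intro b hb
          simp only [Finset.mem_union, Finset.mem_Icc, Finset.mem_Ioc] at hb ⊢
          omega
      _ ≤ ∑ b ∈ Finset.Icc 1 V, a b + ∑ b ∈ Finset.Ioc V X, a b := by
          rw [← Finset.sum_union_inter]
          exact le_add_of_nonneg_right (Finset.sum_nonneg fun _ _ => norm_nonneg _)
      _ ≤ _ := by
          gcongr
          · have := Finset.sum_le_card_nsmul _ _ _ hI
            rwa [Nat.card_Icc, Nat.add_sub_cancel, nsmul_eq_mul] at this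
          · exact sum_Ioc_le_of_dyadic (fun _ => norm_nonneg _) hV X h₂
  rw [hsplit, add_assoc]
  refine (norm_add_le _ _).trans (add_le_add (norm_small_vonMangoldt_sum_le hF V X) ?_)
  refine le_trans (norm_sum_le_of_le _ fun b _ => ?_) hsum
  rw [norm_mul, ← one_mul (a b)]
  gcongr
  exact norm_moebius_le_one b

/-! ### Bilinear sums -/

theorem sum_norm_sq_le_double_sum {ι κ : Type*} (s : Finset ι) (t : Finset κ) {w : ι → κ → ℂ}
    {g : κ → ℝ} {G : ι → κ → ℂ} {L : ℝ} (hw : ∀ b ∈ s, ∀ k ∈ t, w b k = g k * G b k)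
    (hg0 : ∀ k ∈ t, 0 ≤ g k) (hgL : ∀ k ∈ t, g k ≤ L) :
    ∑ b ∈ s, ‖∑ k ∈ t, w b k‖ ^ 2 ≤
      L ^ 2 * ∑ k' ∈ t, ∑ k ∈ t, ‖∑ b ∈ s, G b k * conj (G b k')‖ := by
  have h1 : ((∑ b ∈ s, ‖∑ k ∈ t, w b k‖ ^ 2 : ℝ) : ℂ) =
      ∑ k' ∈ t, ∑ k ∈ t, (g k' * g k : ℂ) * ∑ b ∈ s, G b k * conj (G b k') := by
    rw [Complex.ofReal_sum]
    simp_rw [Finset.mul_sum]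
    rw [Finset.sum_congr rfl (fun k' _ => Finset.sum_comm), Finset.sum_comm]
    refine Finset.sum_congr rfl fun b hb => ?_
    rw [Complex.ofReal_pow, ← Complex.conj_mul', map_sum, Finset.sum_mul_sum]
    refine Finset.sum_congr rfl fun k' hk' => Finset.sum_congr rfl fun k hk => ?_
    rw [hw b hb k hk, hw b hb k' hk', map_mul, Complex.conj_ofReal]
    ring
  have h2 : ∑ b ∈ s, ‖∑ k ∈ t, w b k‖ ^ 2 =
      ‖((∑ b ∈ s, ‖∑ k ∈ t, w b k‖ ^ 2 : ℝ) : ℂ)‖ := by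
    rw [Complex.norm_real, Real.norm_eq_abs, abs_of_nonneg]
    exact Finset.sum_nonneg fun _ _ => sq_nonneg _
  rw [h2, h1, Finset.mul_sum]
  refine norm_sum_le_of_le _ fun k' hk' => ?_
  rw [Finset.mul_sum]
  refine norm_sum_le_of_le _ fun k hk => ?_
  rw [norm_mul, norm_mul, Complex.norm_real, Complex.norm_real, Real.norm_eq_abs,
    Real.norm_eq_abs, abs_of_nonneg (hg0 k hk), abs_of_nonneg (hg0 k' hk'), sq]
  exact mul_le_mul_of_nonneg_right (mul_le_mul (hgL k' hk') (hgL k hk) (hg0 k hk)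
    ((hg0 k' hk').trans (hgL k' hk'))) (norm_nonneg _)

/-- Cauchy–Schwarz in `b`, expansion in pairs `k`, `k'`, and the choice of the worst `k'`. The
condition `b * k ≤ X` is first moved into `G` to make the range of `k` independent of `b`, then
returned as a cutoff on `b`. -/
theorem exists_bilinear_correlation {F : ℕ → ℂ} {g : ℕ → ℝ} {L T : ℝ} {M X : ℕ} (hM : 1 ≤ M)
    (hg0 : ∀ k, 0 ≤ g k) (hgL : ∀ k, k ≤ X → g k ≤ L) (hT : 0 < T)
    (h : T ≤ ∑ b ∈ Finset.Ioc M (2 * M), ‖∑ k ∈ Finset.Icc 1 (X / b), (g k : ℂ) * F (b * k)‖) :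
    ∃ k', 1 ≤ k' ∧ T ^ 2 ≤ M * (X / M : ℕ) * L ^ 2 * ∑ k ∈ Finset.Icc 1 (X / M),
      ‖∑ b ∈ Finset.Ioc M (min (2 * M) (min (X / k) (X / k'))),
        F (b * k) * conj (F (b * k'))‖ := by
  set N := X / M with hN
  set G : ℕ → ℕ → ℂ := fun b k => if b * k ≤ X then F (b * k) else 0 with hG
  have e : ∀ b ∈ Finset.Ioc M (2 * M), ∑ k ∈ Finset.Icc 1 (X / b), (g k : ℂ) * F (b * k) =
      ∑ k ∈ Finset.Icc 1 N, (g k : ℂ) * G b k := by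
    intro b hb
    have hb1 := (Finset.mem_Ioc.mp hb).1
    have hle : X / b ≤ N := Nat.div_le_div_left hb1.le hM
    refine Finset.sum_subset_zero_on_sdiff (Finset.Icc_subset_Icc_right hle) ?_ ?_
    · intro k hk
      simp only [Finset.mem_sdiff, Finset.mem_Icc] at hk
      have : ¬ b * k ≤ X := by
        rw [mul_comm, ← Nat.le_div_iff_mul_le (by omega)]
        omega
      simp [hG, this]
    · intro k hk
      have : b * k ≤ X := by
        rw [mul_comm, ← Nat.le_div_iff_mul_le (by omega)]
        exact (Finset.mem_Icc.mp hk).2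
      simp [hG, this]
  rw [Finset.sum_congr rfl (fun b hb => by rw [e b hb])] at h
  have h1 := sq_sum_le_card_mul_sum_sq (s := Finset.Ioc M (2 * M))
    (f := fun b => ‖∑ k ∈ Finset.Icc 1 N, (g k : ℂ) * G b k‖)
  rw [Nat.card_Ioc, show 2 * M - M = M by omega] at h1
  have hkX : ∀ k ∈ Finset.Icc 1 N, k ≤ X := fun k hk =>
    (Finset.mem_Icc.mp hk).2.trans (Nat.div_le_self _ _)
  have h2 := sum_norm_sq_le_double_sum (Finset.Ioc M (2 * M)) (Finset.Icc 1 N) (g := g) (G := G)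
    (w := fun b k => (g k : ℂ) * G b k) (fun _ _ _ _ => rfl) (fun k _ => hg0 k)
    (fun k hk => hgL k (hkX k hk))
  have h3 : T ^ 2 ≤ M * (L ^ 2 * ∑ k' ∈ Finset.Icc 1 N, ∑ k ∈ Finset.Icc 1 N,
      ‖∑ b ∈ Finset.Ioc M (2 * M), G b k * conj (G b k')‖) := by
    calc T ^ 2 ≤ (∑ b ∈ Finset.Ioc M (2 * M), ‖∑ k ∈ Finset.Icc 1 N, (g k : ℂ) * G b k‖) ^ 2 := by
          gcongr
      _ ≤ _ := h1
      _ ≤ _ := by gcongr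
  have hne : (Finset.Icc 1 N).Nonempty := by
    by_contra hne
    rw [Finset.not_nonempty_iff_eq_empty] at hne
    rw [hne] at h3
    simp only [Finset.sum_empty, mul_zero] at h3
    nlinarith
  obtain ⟨k', hk', hmax⟩ := Finset.exists_max_image (Finset.Icc 1 N)
    (fun k' => ∑ k ∈ Finset.Icc 1 N, ‖∑ b ∈ Finset.Ioc M (2 * M), G b k * conj (G b k')‖) hne
  have hk'1 := (Finset.mem_Icc.mp hk').1
  refine ⟨k', hk'1, ?_⟩
  have h4 := Finset.sum_le_card_nsmul _ _ _ hmax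
  rw [Nat.card_Icc, Nat.add_sub_cancel, nsmul_eq_mul] at h4
  have h5 : ∑ k ∈ Finset.Icc 1 N, ‖∑ b ∈ Finset.Ioc M (2 * M), G b k * conj (G b k')‖ =
      ∑ k ∈ Finset.Icc 1 N, ‖∑ b ∈ Finset.Ioc M (min (2 * M) (min (X / k) (X / k'))),
        F (b * k) * conj (F (b * k'))‖ := by
    refine Finset.sum_congr rfl fun k hk => ?_
    have hk1 := (Finset.mem_Icc.mp hk).1
    congr 1
    symm
    refine Finset.sum_subset_zero_on_sdiff (Finset.Ioc_subset_Ioc_right (min_le_left _ _)) ?_ ?_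
    · intro b hb
      simp only [Finset.mem_sdiff, Finset.mem_Ioc, not_and, le_min_iff] at hb
      have := hb.2 hb.1.1 hb.1.2
      rw [Nat.le_div_iff_mul_le hk1, Nat.le_div_iff_mul_le hk'1] at this
      by_cases hbk : b * k ≤ X
      · simp [hG, this hbk]
      · simp [hG, hbk]
    · intro b hb
      simp only [Finset.mem_Ioc, le_min_iff, Nat.le_div_iff_mul_le hk1,
        Nat.le_div_iff_mul_le hk'1] at hb
      simp [hG, hb.2.2.1, hb.2.2.2]
  rw [← h5]
  calc T ^ 2 ≤ _ := h3
    _ ≤ M * (L ^ 2 * (N * ∑ k ∈ Finset.Icc 1 N,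
      ‖∑ b ∈ Finset.Ioc M (2 * M), G b k * conj (G b k')‖)) := by gcongr
    _ = _ := by ring

/-- The sum is a difference of two initial segments, one of which must be large; length `3 * M`
accommodates both, and replacing `Q` by `Q ^ 2` absorbs the constants. -/
theorem weyl_cubic_Ioc : ∃ K : ℕ, 1 ≤ K ∧ ∀ {Q : ℝ}, 100 ≤ Q → ∀ {M Z : ℕ}, 1 ≤ M → Z ≤ 2 * M →
    ∀ α₃ α₂ β γ : ℝ,
    M / Q ≤ ‖∑ n ∈ Finset.Ioc M Z, expo (α₃ * (n : ℝ) ^ 3 + α₂ * (n : ℝ) ^ 2 + β * n + γ)‖ →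
    ∃ q : ℕ, 1 ≤ q ∧ (q : ℝ) ≤ Q ^ K ∧ distInt (q * α₂) ≤ Q ^ K / M ^ 2 ∧
      distInt (q * α₃) ≤ Q ^ K / M ^ 3 := by
  obtain ⟨K, hK, hW⟩ := weyl_cubic
  refine ⟨2 * K, by omega, ?_⟩
  intro Q hQ M Z hM hZ α₃ α₂ β γ h
  have hQ0 : 0 < Q := by linarith
  have hM0 : (0 : ℝ) < M := by exact_mod_cast hM
  set f : ℕ → ℂ := fun n => expo (α₃ * (n : ℝ) ^ 3 + α₂ * (n : ℝ) ^ 2 + β * n + γ) with hf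
  have hMZ : M ≤ Z := by
    by_contra! hlt
    rw [Finset.Ioc_eq_empty (by omega), Finset.sum_empty, norm_zero] at h
    have : 0 < M / Q := by positivity
    linarith
  have hsplit : ∑ n ∈ Finset.Ioc M Z, f n =
      ∑ n ∈ Finset.range (Z + 1), f n - ∑ n ∈ Finset.range (M + 1), f n := by
    rw [← Finset.sum_Ico_eq_sub _ (by omega)]
    congr 1
    ext n
    simp only [Finset.mem_Ioc, Finset.mem_Ico]
    omega
  have key : ∃ Y ≤ 3 * M, ((3 * M : ℕ) : ℝ) / Q ^ 2 ≤ ‖∑ n ∈ Finset.range Y, f n‖ := by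
    by_contra! hcon
    have h1 := hcon (Z + 1) (by omega)
    have h2 := hcon (M + 1) (by omega)
    have h3 := norm_sub_le (∑ n ∈ Finset.range (Z + 1), f n) (∑ n ∈ Finset.range (M + 1), f n)
    rw [← hsplit] at h3
    have h4 : ((3 * M : ℕ) : ℝ) / Q ^ 2 ≤ M / Q / 2 := by
      push_cast
      rw [div_div, div_le_div_iff₀ (by positivity) (by positivity)]
      nlinarith [mul_pos hM0 hQ0]
    linarith
  obtain ⟨Y, hY, hYf⟩ := key
  obtain ⟨q, hq1, hqQ, hq2, hq3⟩ := hW (Q := Q ^ 2) (by nlinarith) (by omega) hY _ _ _ _ hYf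
  rw [← pow_mul] at hqQ hq2 hq3
  have h3M : (M : ℝ) ≤ (3 * M : ℕ) := by exact_mod_cast (by omega)
  exact ⟨q, hq1, hqQ, hq2.trans (by gcongr), hq3.trans (by gcongr)⟩

/-- Many `k` such that `(k³ - k'³) α₃` and `(k² - k'²) α₂` are simultaneously approximable force
approximations to `α₃` and `α₂`. -/
theorem approximation_of_many_differences (Kw : ℕ) : ∃ K : ℕ, 1 ≤ K ∧ ∀ {Q : ℝ}, 100 ≤ Q →
    ∀ {M N k' : ℕ} {H : Finset ℕ}, H ⊆ Finset.Icc 1 N → Q ^ K ≤ M → Q ^ K ≤ N →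
    N / Q ≤ H.card → ∀ {α₃ α₂ : ℝ},
    (∀ k ∈ H, ∃ q : ℕ, 1 ≤ q ∧ (q : ℝ) ≤ Q ^ Kw ∧
      distInt (q * (α₂ * ((k : ℝ) ^ 2 - k' ^ 2))) ≤ Q ^ Kw / M ^ 2 ∧
      distInt (q * (α₃ * ((k : ℝ) ^ 3 - k' ^ 3))) ≤ Q ^ Kw / M ^ 3) →
    ∃ q : ℕ, 1 ≤ q ∧ (q : ℝ) ≤ Q ^ K ∧ distInt (q * α₂) ≤ Q ^ K / (M * (N + 1)) ^ 2 ∧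
      distInt (q * α₃) ≤ Q ^ K / (M * (N + 1)) ^ 3 := by
  obtain ⟨K₂, hK₂, hR₂⟩ := recurrence_quadratic
  obtain ⟨K₃, hK₃, hR₃⟩ := recurrence_cubic
  refine ⟨(Kw + 2) * (K₂ + K₃ + 2), by nlinarith, ?_⟩
  intro Q hQ M N k' H hH hM hN hcard α₃ α₂ hd
  have hQ0 : 0 < Q := by linarith
  have hQ1 : 1 ≤ Q := by linarith
  have hM0 : (0 : ℝ) < M := lt_of_lt_of_le (by positivity) hM
  have hN0 : (0 : ℝ) < N := lt_of_lt_of_le (by positivity) hN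
  have hN1 : (1 : ℝ) ≤ N := by exact_mod_cast hN0
  have hM1 : (1 : ℝ) ≤ M := by exact_mod_cast hM0
  choose! q hq1 hqQ hq2 hq3 using hd
  -- Fix the value `r` of the multiplier on a dense subset. The conditions then say that polynomials
  -- in `k` with leading coefficients `r α₂` and `r α₃` are near integers, with `k'` only in the
  -- constant term.
  obtain ⟨r, hr, hfib⟩ := Finset.exists_le_card_fiber_of_nsmul_le_card_of_maps_to
    (s := H) (t := Finset.Icc 1 ⌊Q ^ Kw⌋₊) (f := q) (b := (N : ℝ) / Q ^ (Kw + 1))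
    (fun h hh => Finset.mem_Icc.mpr ⟨hq1 h hh, Nat.le_floor (hqQ h hh)⟩)
    ⟨1, Finset.mem_Icc.mpr ⟨le_rfl, Nat.le_floor (by push_cast; exact one_le_pow₀ hQ1)⟩⟩
    (by
      rw [Nat.card_Icc, Nat.add_sub_cancel, nsmul_eq_mul]
      calc (⌊Q ^ Kw⌋₊ : ℝ) * (N / Q ^ (Kw + 1)) ≤ Q ^ Kw * (N / Q ^ (Kw + 1)) := by
            gcongr; exact Nat.floor_le (by positivity)
        _ = N / Q := by field_simp; ring
        _ ≤ _ := hcard)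
  obtain ⟨hr1, hr2⟩ := Finset.mem_Icc.mp hr
  have hrQ : (r : ℝ) ≤ Q ^ Kw := (Nat.cast_le.mpr hr2).trans (Nat.floor_le (by positivity))
  set H' := H.filter (fun h => q h = r) with hH'
  have hH'N : H' ⊆ Finset.range (N + 1) := by
    intro k hk
    have := Finset.mem_Icc.mp (hH (Finset.mem_filter.mp hk).1)
    exact Finset.mem_range.mpr (by omega)
  -- Length `N + 1` rather than `N` is kept because `X ≤ M * (N + 1)` when `N = X / M`, so the final
  -- errors are bounded in terms of `X`.
  have hcard' : ((N + 1 : ℕ) : ℝ) / Q ^ (Kw + 2) ≤ H'.card := by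
    refine le_trans ?_ hfib
    rw [div_le_div_iff₀ (by positivity) (by positivity)]
    push_cast
    calc ((N : ℝ) + 1) * Q ^ (Kw + 1) ≤ (Q * N) * Q ^ (Kw + 1) := by
          gcongr; nlinarith
      _ = _ := by ring
  have hQ100 : 100 ≤ Q ^ (Kw + 2) := hQ.trans (le_self_pow₀ hQ1 (by omega))
  have hQS : Q ^ Kw ≤ Q ^ (Kw + 2) := pow_le_pow_right₀ hQ1 (by omega)
  rw [pow_mul] at hM hN
  rw [pow_mul Q (Kw + 2)]
  have hd2 : ∀ n ∈ H', distInt ((r * α₂) * (n : ℝ) ^ 2 + 0 * n + (-(r * α₂ * k' ^ 2))) ≤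
      Q ^ (Kw + 2) / M ^ 2 := by
    intro n hn
    obtain ⟨hn1, hn2⟩ := Finset.mem_filter.mp hn
    have := hq2 n hn1
    rw [hn2] at this
    refine le_trans (le_of_eq ?_) (this.trans (by gcongr))
    congr 1; ring
  have hd3 : ∀ n ∈ H', distInt ((r * α₃) * (n : ℝ) ^ 3 + 0 * (n : ℝ) ^ 2 + 0 * n +
      (-(r * α₃ * k' ^ 3))) ≤ Q ^ (Kw + 2) / M ^ 3 := by
    intro n hn
    obtain ⟨hn1, hn2⟩ := Finset.mem_filter.mp hn
    have := hq3 n hn1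
    rw [hn2] at this
    refine le_trans (le_of_eq ?_) (this.trans (by gcongr))
    congr 1; ring
  have hrS : (r : ℝ) ≤ Q ^ (Kw + 2) := hrQ.trans hQS
  generalize Q ^ (Kw + 2) = S at *
  have hS1 : 1 ≤ S := by linarith
  have hS0 : 0 < S := by linarith
  have hsmall : ∀ j d : ℕ, j ≤ K₂ + K₃ → 1 ≤ d → S / (M : ℝ) ^ d ≤ 1 / S ^ j := by
    intro j d hj hd
    rw [div_le_div_iff₀ (by positivity) (by positivity), one_mul]
    calc S * S ^ j = S ^ (j + 1) := by ring
      _ ≤ S ^ (K₂ + K₃ + 2) := pow_le_pow_right₀ hS1 (by omega)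
      _ ≤ M := hM
      _ ≤ _ := le_self_pow₀ hM1 (by omega)
  have hbig : ∀ j : ℕ, j ≤ K₂ + K₃ → S ^ j ≤ ((N + 1 : ℕ) : ℝ) := by
    intro j hj
    push_cast
    have := (pow_le_pow_right₀ hS1 (by omega : j ≤ K₂ + K₃ + 2)).trans hN
    linarith
  obtain ⟨s, hs1, hsS, hs⟩ := hR₂ hQ100 hH'N (hbig _ (by omega)) hcard'
    (hsmall _ 2 (by omega) (by norm_num)) hd2
  obtain ⟨t, ht1, htS, ht⟩ := hR₃ hQ100 hH'N (hbig _ (by omega)) hcard'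
    (hsmall _ 3 (by omega) (by norm_num)) hd3
  refine ⟨r * s * t, Nat.mul_pos (Nat.mul_pos hr1 hs1) ht1, ?_, ?_, ?_⟩
  · push_cast
    calc (r : ℝ) * s * t ≤ S * S ^ K₂ * S ^ K₃ := by gcongr
      _ = S ^ (K₂ + K₃ + 1) := by ring
      _ ≤ _ := pow_le_pow_right₀ hS1 (by omega)
  · rw [show ((r * s * t : ℕ) : ℝ) * α₂ = t * (s * (r * α₂)) by push_cast; ring]
    refine (distInt_natCast_mul_le _ _).trans ?_
    calc t * distInt (s * (r * α₂)) ≤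
          S ^ K₃ * (S ^ K₂ * (S / M ^ 2) / ((N + 1 : ℕ) : ℝ) ^ 2) := by
          gcongr
          exact distInt_nonneg _
      _ = S ^ (K₂ + K₃ + 1) / (M * (N + 1)) ^ 2 := by push_cast; field_simp; ring
      _ ≤ _ := by
        gcongr ?_ / _
        exact pow_le_pow_right₀ hS1 (by omega)
  · rw [show ((r * s * t : ℕ) : ℝ) * α₃ = s * (t * (r * α₃)) by push_cast; ring]
    refine (distInt_natCast_mul_le _ _).trans ?_
    calc s * distInt (t * (r * α₃)) ≤
          S ^ K₂ * (S ^ K₃ * (S / M ^ 3) / ((N + 1 : ℕ) : ℝ) ^ 3) := by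
          gcongr
          exact distInt_nonneg _
      _ = S ^ (K₂ + K₃ + 1) / (M * (N + 1)) ^ 3 := by push_cast; field_simp; ring
      _ ≤ _ := by
        gcongr ?_ / _
        exact pow_le_pow_right₀ hS1 (by omega)

/-- The cubic phase `e(α₁ n + α₂ n² + α₃ n³)`. -/
noncomputable def cubicPhase (α₁ α₂ α₃ : ℝ) (n : ℕ) : ℂ :=
  expo (α₁ * (n : ℝ) + α₂ * (n : ℝ) ^ 2 + α₃ * (n : ℝ) ^ 3)

theorem norm_cubicPhase (α₁ α₂ α₃ : ℝ) (n : ℕ) : ‖cubicPhase α₁ α₂ α₃ n‖ = 1 := norm_expo _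

theorem cubicPhase_mul_conj (α₁ α₂ α₃ : ℝ) (b k k' : ℕ) :
    cubicPhase α₁ α₂ α₃ (b * k) * conj (cubicPhase α₁ α₂ α₃ (b * k')) =
      expo ((α₃ * ((k : ℝ) ^ 3 - k' ^ 3)) * (b : ℝ) ^ 3 + (α₂ * ((k : ℝ) ^ 2 - k' ^ 2)) *
        (b : ℝ) ^ 2 + (α₁ * ((k : ℝ) - k')) * b + 0) := by
  unfold cubicPhase
  rw [expo_mul_conj]
  congr 1
  push_cast; ring

/-- A large bilinear sum of the cubic phase forces approximations to `α₂` and `α₃`. -/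
theorem bilinear_cubic : ∃ K : ℕ, 1 ≤ K ∧ ∀ {Q : ℝ}, 100 ≤ Q → ∀ {M V X : ℕ} {g : ℕ → ℝ},
    Q ^ K ≤ V → V ≤ M → 1 ≤ X → (∀ k, 0 ≤ g k) → (∀ k ≤ X, g k ≤ Q) → (∀ k ≤ V, g k = 0) →
    ∀ {α₁ α₂ α₃ : ℝ}, X / Q ≤ ∑ b ∈ Finset.Ioc M (2 * M),
      ‖∑ k ∈ Finset.Icc 1 (X / b), (g k : ℂ) * cubicPhase α₁ α₂ α₃ (b * k)‖ →
    ∃ q : ℕ, 1 ≤ q ∧ (q : ℝ) ≤ Q ^ K ∧ distInt (q * α₂) ≤ Q ^ K / X ^ 2 ∧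
      distInt (q * α₃) ≤ Q ^ K / X ^ 3 := by
  obtain ⟨Kw, hKw, hW⟩ := weyl_cubic_Ioc
  obtain ⟨K, hK, hdiff⟩ := approximation_of_many_differences Kw
  refine ⟨5 * K, by omega, ?_⟩
  intro Q hQ M V X g hV hVM hX hg0 hgQ hgV α₁ α₂ α₃ h
  have hQ0 : 0 < Q := by linarith
  have hQ1 : 1 ≤ Q := by linarith
  have hX0 : (0 : ℝ) < X := by exact_mod_cast hX
  have hV0 : (0 : ℝ) < V := lt_of_lt_of_le (by positivity) hV
  have hM0 : (0 : ℝ) < M := lt_of_lt_of_le hV0 (by exact_mod_cast hVM)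
  have hM1 : 1 ≤ M := by exact_mod_cast hM0
  have hT : 0 < X / Q := by positivity
  set N := X / M with hN
  -- If `X / M < V`, every `k` in the sum satisfies `k ≤ V`, where the weight vanishes.
  have hVN : V ≤ N := by
    by_contra! hlt
    have : ∑ b ∈ Finset.Ioc M (2 * M),
        ‖∑ k ∈ Finset.Icc 1 (X / b), (g k : ℂ) * cubicPhase α₁ α₂ α₃ (b * k)‖ = 0 := by
      refine Finset.sum_eq_zero fun b hb => ?_
      rw [norm_eq_zero]
      refine Finset.sum_eq_zero fun k hk => ?_
      have h1 : X / b ≤ N := Nat.div_le_div_left (Finset.mem_Ioc.mp hb).1.le hM1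
      rw [hgV k (by have := (Finset.mem_Icc.mp hk).2; omega)]
      simp
    linarith
  have hN0 : (0 : ℝ) < N := lt_of_lt_of_le hV0 (by exact_mod_cast hVN)
  obtain ⟨k', hk', hcorr⟩ := exists_bilinear_correlation hM1 hg0 hgQ hT h
  set S : ℕ → ℝ := fun k => ‖∑ b ∈ Finset.Ioc M (min (2 * M) (min (X / k) (X / k'))),
    cubicPhase α₁ α₂ α₃ (b * k) * conj (cubicPhase α₁ α₂ α₃ (b * k'))‖ with hS
  have hMNX : (M : ℝ) * N ≤ X := by exact_mod_cast Nat.mul_div_le X M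
  have hXMN : (X : ℝ) ≤ M * (N + 1) := by
    exact_mod_cast (Nat.lt_mul_div_succ X hM1).le
  have hsum : (M : ℝ) * N / Q ^ 4 ≤ ∑ k ∈ Finset.Icc 1 N, S k := by
    have h1 : ((M : ℝ) * N) ^ 2 / Q ^ 2 ≤ M * N * Q ^ 2 * ∑ k ∈ Finset.Icc 1 N, S k := by
      calc ((M : ℝ) * N) ^ 2 / Q ^ 2 ≤ (X : ℝ) ^ 2 / Q ^ 2 := by gcongr
        _ = (X / Q) ^ 2 := by rw [div_pow]
        _ ≤ _ := hcorr
    have h2 : ((M : ℝ) * N) ^ 2 / Q ^ 2 = M * N * Q ^ 2 * (M * N / Q ^ 4) := by field_simp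
    rw [h2] at h1
    exact le_of_mul_le_mul_left h1 (by positivity)
  have hSM : ∀ k ∈ Finset.Icc 1 N, S k ≤ M := by
    intro k _
    refine (norm_sum_le_of_le _ (fun b _ => (show _ ≤ (1 : ℝ) from ?_))).trans ?_
    · rw [norm_mul, Complex.norm_conj, norm_cubicPhase, norm_cubicPhase, one_mul]
    · rw [Finset.sum_const, nsmul_eq_mul, mul_one, Nat.card_Ioc]
      exact_mod_cast (by omega)
  have hcount := card_filter_ge_of_sum_ge (c := M / Q ^ 5) hSM (by positivity) hsum
  rw [Nat.card_Icc, Nat.add_sub_cancel] at hcount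
  have hcard : (N : ℝ) / Q ^ 5 ≤
      ((Finset.Icc 1 N).filter (fun k => (M : ℝ) / Q ^ 5 ≤ S k)).card := by
    refine le_of_mul_le_mul_right (le_trans ?_ hcount) hM0
    rw [show (M : ℝ) * N / Q ^ 4 - N * (M / Q ^ 5) = N * M / Q ^ 5 * (Q - 1) by field_simp,
      show (N : ℝ) / Q ^ 5 * M = N * M / Q ^ 5 * 1 by ring]
    gcongr
    linarith
  have hQ5 : 100 ≤ Q ^ 5 := hQ.trans (le_self_pow₀ hQ1 (by norm_num))
  obtain ⟨q, hq1, hqQ, hq2, hq3⟩ := hdiff hQ5 (Finset.filter_subset _ _)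
    (by rw [← pow_mul]; exact hV.trans (by exact_mod_cast hVM))
    (by rw [← pow_mul]; exact hV.trans (by exact_mod_cast hVN)) hcard
    (α₃ := α₃) (α₂ := α₂) (k' := k') (by
      intro k hk
      have hk := (Finset.mem_filter.mp hk).2
      simp only [hS, cubicPhase_mul_conj] at hk
      exact hW hQ5 hM1 (min_le_left _ _) _ _ _ _ hk)
  rw [← pow_mul] at hqQ hq2 hq3
  exact ⟨q, hq1, hqQ, hq2.trans (by gcongr), hq3.trans (by gcongr)⟩

/-! ### The sum over `Λ` -/

/-- A large sum of the first type forces approximations to `α₂` and `α₃`. -/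
theorem linear_sum_cubic : ∃ K : ℕ, 1 ≤ K ∧ ∀ {Q : ℝ}, 100 ≤ Q → ∀ {d Z X : ℕ}, 1 ≤ d →
    (d : ℝ) ≤ Q → Z ≤ X → Q ^ K ≤ X → ∀ {α₁ α₂ α₃ : ℝ},
    X / Q ≤ ‖∑ l ∈ Finset.Icc 1 Z, cubicPhase α₁ α₂ α₃ (d * l)‖ →
    ∃ q : ℕ, 1 ≤ q ∧ (q : ℝ) ≤ Q ^ K ∧ distInt (q * α₂) ≤ Q ^ K / X ^ 2 ∧
      distInt (q * α₃) ≤ Q ^ K / X ^ 3 := by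
  obtain ⟨K, hK, hW⟩ := weyl_cubic
  refine ⟨2 * K + 3, by omega, ?_⟩
  intro Q hQ d Z X hd hdQ hZ hX α₁ α₂ α₃ h
  have hQ0 : 0 < Q := by linarith
  have hQ1 : 1 ≤ Q := by linarith
  have hX0 : (0 : ℝ) < X := lt_of_lt_of_le (by positivity) hX
  have hQX : Q ^ 2 ≤ X := (pow_le_pow_right₀ hQ1 (by omega)).trans hX
  have e : ∑ n ∈ Finset.range (Z + 1), expo ((d ^ 3 : ℕ) * α₃ * (n : ℝ) ^ 3 +
      (d ^ 2 : ℕ) * α₂ * (n : ℝ) ^ 2 + d * α₁ * n + 0) =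
      1 + ∑ l ∈ Finset.Icc 1 Z, cubicPhase α₁ α₂ α₃ (d * l) := by
    rw [Finset.range_eq_Ico, Finset.sum_eq_sum_Ico_succ_bot (by omega)]
    congr 1
    · simp [expo_zero]
    · refine Finset.sum_congr rfl fun l _ => ?_
      unfold cubicPhase
      congr 1
      push_cast; ring
  have h1 : ((X + 1 : ℕ) : ℝ) / Q ^ 2 ≤ ‖∑ n ∈ Finset.range (Z + 1),
      expo ((d ^ 3 : ℕ) * α₃ * (n : ℝ) ^ 3 +
      (d ^ 2 : ℕ) * α₂ * (n : ℝ) ^ 2 + d * α₁ * n + 0)‖ := by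
    rw [e]
    have h2 := norm_sub_le_norm_add (∑ l ∈ Finset.Icc 1 Z, cubicPhase α₁ α₂ α₃ (d * l)) 1
    rw [norm_one, add_comm] at h2
    have h3 : ((X + 1 : ℕ) : ℝ) / Q ^ 2 ≤ X / Q - 1 := by
      rw [div_le_iff₀ (by positivity), show (X / Q - 1) * Q ^ 2 = X * Q - Q ^ 2 by field_simp]
      push_cast
      nlinarith
    linarith
  obtain ⟨q, hq1, hqQ, hq2, hq3⟩ := hW (Q := Q ^ 2) (by nlinarith) (by omega) (by omega) _ _ _ _ h1
  rw [← pow_mul] at hqQ hq2 hq3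
  have hXX : (X : ℝ) ≤ (X + 1 : ℕ) := by exact_mod_cast X.le_succ
  refine ⟨q * d ^ 3, Nat.mul_pos hq1 (pow_pos hd 3), ?_, ?_, ?_⟩
  · push_cast
    calc (q : ℝ) * d ^ 3 ≤ Q ^ (2 * K) * Q ^ 3 := by gcongr
      _ = _ := by rw [← pow_add]
  · rw [show ((q * d ^ 3 : ℕ) : ℝ) * α₂ = d * (q * ((d ^ 2 : ℕ) * α₂)) by push_cast; ring]
    refine (distInt_natCast_mul_le _ _).trans ?_
    calc d * distInt (q * ((d ^ 2 : ℕ) * α₂)) ≤ Q * (Q ^ (2 * K) / ((X + 1 : ℕ) : ℝ) ^ 2) := by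
          gcongr
          exact distInt_nonneg _
      _ ≤ Q * (Q ^ (2 * K) / (X : ℝ) ^ 2) := by gcongr
      _ = Q ^ (2 * K + 1) / (X : ℝ) ^ 2 := by ring
      _ ≤ _ := by
        gcongr ?_ / _
        exact pow_le_pow_right₀ hQ1 (by omega)
  · rw [show ((q * d ^ 3 : ℕ) : ℝ) * α₃ = q * ((d ^ 3 : ℕ) * α₃) by push_cast; ring]
    refine hq3.trans ?_
    calc Q ^ (2 * K) / ((X + 1 : ℕ) : ℝ) ^ 3 ≤ Q ^ (2 * K) / (X : ℝ) ^ 3 := by gcongr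
      _ ≤ _ := by
        gcongr ?_ / _
        exact pow_le_pow_right₀ hQ1 (by omega)

theorem natLog_two_add_one_le (X : ℕ) : ((Nat.log 2 X + 1 : ℕ) : ℝ) ≤ 2 * Real.log X + 1 := by
  rcases Nat.eq_zero_or_pos X with rfl | hX
  · simp
  have h1 : ((2 ^ Nat.log 2 X : ℕ) : ℝ) ≤ X := by exact_mod_cast Nat.pow_log_le_self 2 hX.ne'
  have h2 := Real.log_le_log (by positivity) h1
  push_cast at h2 ⊢
  rw [Real.log_pow] at h2
  have h3 := Real.log_two_gt_d9
  nlinarith [Nat.cast_nonneg (α := ℝ) (Nat.log 2 X)]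

/-- If no such `q` existed, both types of sum in Vaughan's decomposition would be small, bounding
the total by `3 X / Q ^ 2 < X / Q`. -/
theorem vonMangoldt_sum_cubic : ∃ K : ℕ, 1 ≤ K ∧ ∀ {Q : ℝ}, 100 ≤ Q → ∀ {X : ℕ},
    Q ^ K ≤ X → Real.log X ≤ Q → ∀ {α₁ α₂ α₃ : ℝ},
    X / Q ≤ ‖∑ n ∈ Finset.Icc 1 X, (Λ n : ℂ) * cubicPhase α₁ α₂ α₃ n‖ →
    ∃ q : ℕ, 1 ≤ q ∧ (q : ℝ) ≤ Q ^ K ∧ distInt (q * α₂) ≤ Q ^ K / X ^ 2 ∧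
      distInt (q * α₃) ≤ Q ^ K / X ^ 3 := by
  obtain ⟨K₁, hK₁, hI⟩ := linear_sum_cubic
  obtain ⟨K₂, hK₂, hII⟩ := bilinear_cubic
  refine ⟨(8 * K₂ + 6) * K₁ + 4 * K₂ + 4, by omega, ?_⟩
  intro Q hQ X hX hlog α₁ α₂ α₃ h
  have hQ0 : 0 < Q := by linarith
  have hQ1 : 1 ≤ Q := by linarith
  have hX0 : (0 : ℝ) < X := lt_of_lt_of_le (by positivity) hX
  have hX1 : 1 ≤ X := by exact_mod_cast hX0
  have hlog0 := Real.log_natCast_nonneg X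
  -- `V` is just large enough for `bilinear_cubic` with parameter `Q ^ 4`. The first-type saving `Q
  -- ^ (8 * K₂ + 6)` beats `V ^ 2 * log X` and also bounds the moduli `d ≤ V * V`.
  set V := ⌈Q ^ (4 * K₂)⌉₊ with hVdef
  have hV1 : Q ^ (4 * K₂) ≤ V := Nat.le_ceil _
  have hV2 : (V : ℝ) ≤ Q ^ (4 * K₂) * 2 := by
    have h1 := (Nat.ceil_lt_add_one (show 0 ≤ Q ^ (4 * K₂) by positivity)).le
    have h2 : 1 ≤ Q ^ (4 * K₂) := one_le_pow₀ hQ1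
    linarith
  have hVpos : 1 ≤ V := by
    have : (0 : ℝ) < V := lt_of_lt_of_le (by positivity) hV1
    exact_mod_cast this
  by_contra hno
  set B₁ : ℝ := X / Q ^ (8 * K₂ + 6) with hB₁
  set B₂ : ℝ := X / Q ^ 4 with hB₂
  have hB₁0 : 0 < B₁ := by positivity
  have h₁ : ∀ d, 1 ≤ d → d ≤ V * V → ∀ Z ≤ X,
      ‖∑ l ∈ Finset.Icc 1 Z, cubicPhase α₁ α₂ α₃ (d * l)‖ ≤ B₁ := by
    intro d hd hdV Z hZ
    by_contra! hlt
    refine hno ?_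
    obtain ⟨q, hq1, hqQ, hq2, hq3⟩ := hI (Q := Q ^ (8 * K₂ + 6))
      (hQ.trans (le_self_pow₀ hQ1 (by omega))) hd (by
        calc (d : ℝ) ≤ V * V := by exact_mod_cast hdV
          _ ≤ (Q ^ (4 * K₂) * 2) * (Q ^ (4 * K₂) * 2) := by gcongr
          _ = Q ^ (8 * K₂) * 4 := by ring
          _ ≤ Q ^ (8 * K₂) * Q ^ 6 := by
            gcongr
            exact le_trans (by linarith) (le_self_pow₀ hQ1 (by norm_num : 6 ≠ 0))
          _ = _ := by rw [← pow_add]) hZ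
      (by rw [← pow_mul]; exact (pow_le_pow_right₀ hQ1 (by omega)).trans hX) hlt.le
    rw [← pow_mul] at hqQ hq2 hq3
    have hle : Q ^ ((8 * K₂ + 6) * K₁) ≤ Q ^ ((8 * K₂ + 6) * K₁ + 4 * K₂ + 4) :=
      pow_le_pow_right₀ hQ1 (by omega)
    exact ⟨q, hq1, hqQ.trans hle, hq2.trans (by gcongr), hq3.trans (by gcongr)⟩
  have h₂ : ∀ M, V ≤ M → ∑ b ∈ Finset.Ioc M (2 * M), ‖∑ k ∈ Finset.Icc 1 (X / b),
      (largeLog V k : ℂ) * cubicPhase α₁ α₂ α₃ (b * k)‖ ≤ B₂ := by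
    intro M hM
    by_contra! hlt
    refine hno ?_
    have hQ4 : Q ≤ Q ^ 4 := le_self_pow₀ hQ1 (by norm_num)
    obtain ⟨q, hq1, hqQ, hq2, hq3⟩ := hII (Q := Q ^ 4) (hQ.trans hQ4)
      (by rw [← pow_mul]; exact hV1) hM hX1 (largeLog_nonneg V)
      (by
        intro k hk
        refine (largeLog_le_log V k).trans (le_trans ?_ (hlog.trans hQ4))
        rcases Nat.eq_zero_or_pos k with rfl | hk0
        · simpa using hlog0
        · exact Real.log_le_log (by exact_mod_cast hk0) (by exact_mod_cast hk))
      (fun k hk => largeLog_eq_zero hk) hlt.le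
    rw [← pow_mul] at hqQ hq2 hq3
    have hle : Q ^ (4 * K₂) ≤ Q ^ ((8 * K₂ + 6) * K₁ + 4 * K₂ + 4) :=
      pow_le_pow_right₀ hQ1 (by omega)
    exact ⟨q, hq1, hqQ.trans hle, hq2.trans (by gcongr), hq3.trans (by gcongr)⟩
  have hV := norm_vonMangoldt_sum_le (F := cubicPhase α₁ α₂ α₃)
    (fun n => (norm_cubicPhase _ _ _ n).le) hVpos h₁ h₂
  have b1 : V * Real.log X ≤ X / Q ^ 2 := by
    rw [le_div_iff₀ (by positivity)]
    calc V * Real.log X * Q ^ 2 ≤ (Q ^ (4 * K₂) * 2) * Q * Q ^ 2 := by gcongr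
      _ ≤ (Q ^ (4 * K₂) * Q) * Q * Q ^ 2 := by gcongr; linarith
      _ = Q ^ (4 * K₂ + 4) := by ring
      _ ≤ Q ^ ((8 * K₂ + 6) * K₁ + 4 * K₂ + 4) := pow_le_pow_right₀ hQ1 (by omega)
      _ ≤ X := hX
  have b2 : V * (3 * V * Real.log X * B₁) ≤ X / Q ^ 2 := by
    calc V * (3 * V * Real.log X * B₁) ≤
        (Q ^ (4 * K₂) * 2) * (3 * (Q ^ (4 * K₂) * 2) * Q * B₁) := by gcongr
      _ = 12 * (Q ^ (8 * K₂ + 1) * B₁) := by ring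
      _ ≤ Q * (Q ^ (8 * K₂ + 1) * B₁) := by gcongr; linarith
      _ = X / Q ^ 4 := by
        rw [hB₁, show 8 * K₂ + 6 = (8 * K₂ + 1 + 1) + 4 by ring, pow_add _ _ 4, pow_succ]
        field_simp
        ring
      _ ≤ X / Q ^ 2 := by
        gcongr X / ?_
        exact pow_le_pow_right₀ hQ1 (by norm_num)
  have b3 : (Nat.log 2 X + 1) * B₂ ≤ X / Q ^ 2 := by
    have h1 := natLog_two_add_one_le X
    push_cast at h1
    calc (Nat.log 2 X + 1) * B₂ ≤ Q ^ 2 * B₂ := by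
          gcongr
          nlinarith
      _ = X / Q ^ 2 := by rw [hB₂]; field_simp
  have b4 : (X : ℝ) / Q ^ 2 * 3 < X / Q := by
    rw [div_mul_eq_mul_div, div_lt_div_iff₀ (by positivity) hQ0]
    nlinarith [mul_pos hX0 hQ0]
  linarith

/-! ### Major arcs and the main theorem -/

/-- Representatives run over `1, …, q` instead of `0, …, q - 1`, as the major arcs require; hence
the shift by one. -/
theorem exists_reduced_residue (a : ℤ) {q : ℕ} (hq : 1 ≤ q) :
    ∃ (r : ℕ) (k : ℤ), 1 ≤ r ∧ r ≤ q ∧ (r : ℤ) = a + k * q := by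
  have hq0 : (0 : ℤ) < q := by exact_mod_cast hq
  have h1 := Int.emod_nonneg (a - 1) hq0.ne'
  have h2 := Int.emod_lt_of_pos (a - 1) hq0
  have h3 := Int.emod_add_mul_ediv (a - 1) q
  refine ⟨((a - 1) % q + 1).toNat, -((a - 1) / q), by omega, by omega, ?_⟩
  rw [Int.toNat_of_nonneg (by omega)]
  linear_combination h3

theorem norm_coe_sub_div_le {α B : ℝ} {q r : ℕ} {a k : ℤ} {g : ℕ} (hq : 1 ≤ q) (hg : 1 ≤ g)
    (hr : (r : ℤ) = a + k * q) (ha : round ((g * q : ℕ) * α) = g * a)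
    (h : distInt ((g * q : ℕ) * α) ≤ B) :
    ‖(α : UnitAddCircle) - (((r : ℝ) / q : ℝ) : UnitAddCircle)‖ ≤ B / q := by
  have hq0 : (0 : ℝ) < q := by exact_mod_cast hq
  have hg1 : (1 : ℝ) ≤ g := by exact_mod_cast hg
  have hg0 : (0 : ℝ) < g := by linarith
  have hB : 0 ≤ B := (distInt_nonneg _).trans h
  rw [← QuotientAddGroup.mk_sub, UnitAddCircle.norm_eq]
  refine (distInt_le_abs_sub _ (-k)).trans ?_
  have hr' : (r : ℝ) = a + k * q := by exact_mod_cast hr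
  have e : α - (r : ℝ) / q - ((-k : ℤ) : ℝ) = (((g * q : ℕ) * α) - (g * a : ℤ)) / (g * q) := by
    rw [hr']; push_cast; field_simp; ring
  rw [e, abs_div, abs_of_pos (mul_pos hg0 hq0), ← ha]
  change distInt ((g * q : ℕ) * α) / (g * q) ≤ B / q
  gcongr
  nlinarith

/-- Take the nearest integers to `q α` and `q β`, cancel their common factor with `q`, and reduce
modulo the new denominator, which only shifts by integers. -/
theorem mem_majorArcs {A P α β : ℝ} {q : ℕ} (hq : 1 ≤ q) (hqA : (q : ℝ) < Real.log P ^ A)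
    (hα : distInt (q * α) ≤ Real.log P ^ A / P ^ 2)
    (hβ : distInt (q * β) ≤ Real.log P ^ A / P ^ 3) :
    ((α : UnitAddCircle), (β : UnitAddCircle)) ∈ majorArcs A P := by
  set a₀ := round (q * α) with ha₀
  set b₀ := round (q * β) with hb₀
  obtain ⟨g, hg⟩ : ∃ g, g = Nat.gcd (Nat.gcd a₀.natAbs b₀.natAbs) q := ⟨_, rfl⟩
  have hgq : g ∣ q := hg ▸ Nat.gcd_dvd_right _ _
  have hga : (g : ℤ) ∣ a₀ := by
    rw [hg, Int.natCast_dvd]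
    exact (Nat.gcd_dvd_left _ _).trans (Nat.gcd_dvd_left _ _)
  have hgb : (g : ℤ) ∣ b₀ := by
    rw [hg, Int.natCast_dvd]
    exact (Nat.gcd_dvd_left _ _).trans (Nat.gcd_dvd_right _ _)
  have hgpos : 1 ≤ g := hg ▸ Nat.gcd_pos_of_pos_right _ hq
  obtain ⟨q', hq'⟩ := hgq
  obtain ⟨a₁, ha₁⟩ := hga
  obtain ⟨b₁, hb₁⟩ := hgb
  have hq'1 : 1 ≤ q' := Nat.pos_of_ne_zero fun h => by simp [h] at hq'; omega
  obtain ⟨a, k, ha1, haq, hak⟩ := exists_reduced_residue a₁ hq'1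
  obtain ⟨b, l, hb1, hbq, hbl⟩ := exists_reduced_residue b₁ hq'1
  refine ⟨q', a, b, hq'1, lt_of_le_of_lt ?_ hqA, ha1, haq, hb1, hbq, ?_, ?_, ?_⟩
  · rw [hq']; exact_mod_cast Nat.le_mul_of_pos_left _ hgpos
  · set p := Nat.gcd (Nat.gcd a b) q' with hp
    have hpq : p ∣ q' := Nat.gcd_dvd_right _ _
    have hpqz : (p : ℤ) ∣ q' := by exact_mod_cast hpq
    have hpa : (p : ℤ) ∣ a₁ := by
      have h1 : (p : ℤ) ∣ a := by
        exact_mod_cast (Nat.gcd_dvd_left _ _).trans (Nat.gcd_dvd_left _ _)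
      rw [hak] at h1
      exact (dvd_add_left (hpqz.mul_left k)).mp h1
    have hpb : (p : ℤ) ∣ b₁ := by
      have h1 : (p : ℤ) ∣ b := by
        exact_mod_cast (Nat.gcd_dvd_left _ _).trans (Nat.gcd_dvd_right _ _)
      rw [hbl] at h1
      exact (dvd_add_left (hpqz.mul_left l)).mp h1
    -- A common factor `p` left after cancellation would make `g * p` divide the greatest common
    -- divisor `g`.
    have h1 : g * p ∣ Nat.gcd (Nat.gcd a₀.natAbs b₀.natAbs) q := by
      refine Nat.dvd_gcd (Nat.dvd_gcd ?_ ?_) ?_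
      · rw [← Int.natCast_dvd, ha₁]; push_cast; exact mul_dvd_mul_left _ hpa
      · rw [← Int.natCast_dvd, hb₁]; push_cast; exact mul_dvd_mul_left _ hpb
      · rw [hq']; exact mul_dvd_mul_left _ hpq
    rw [← hg] at h1
    exact Nat.dvd_one.mp ((Nat.mul_dvd_mul_iff_left hgpos).mp (by simpa using h1))
  · have h1 := norm_coe_sub_div_le hq'1 hgpos hak (α := α) (B := Real.log P ^ A / P ^ 2) (by rw [← hq', ← ha₀, ha₁])
      (by rw [← hq']; exact hα)
    rw [div_div, mul_comm (P ^ 2)] at h1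
    exact h1
  · have h1 := norm_coe_sub_div_le hq'1 hgpos hbl (α := β) (B := Real.log P ^ A / P ^ 3) (by rw [← hq', ← hb₀, hb₁])
      (by rw [← hq']; exact hβ)
    rw [div_div, mul_comm (P ^ 3)] at h1
    exact h1

/-! ### Trivial bounds, prime powers, and large `P`. -/

theorem lambdaSum_eq (P α₁ α₂ α₃ : ℝ) :
    lambdaSum P α₁ α₂ α₃ = ∑ n ∈ Finset.Icc 1 ⌊P⌋₊, (Λ n : ℂ) * cubicPhase α₁ α₂ α₃ n := rfl

theorem norm_lambdaSum_le {P : ℝ} (hP : 2 ≤ P) (α₁ α₂ α₃ : ℝ) :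
    ‖lambdaSum P α₁ α₂ α₃‖ ≤ P * Real.log P := by
  have h := norm_small_vonMangoldt_sum_le (F := cubicPhase α₁ α₂ α₃)
    (fun n => (norm_cubicPhase _ _ _ n).le) ⌊P⌋₊ ⌊P⌋₊
  rw [Finset.sum_congr rfl (fun n hn => by rw [if_pos (Finset.mem_Icc.mp hn).2]),
    ← lambdaSum_eq] at h
  have h1 : (⌊P⌋₊ : ℝ) ≤ P := Nat.floor_le (by linarith)
  have h2 : (0 : ℝ) < ⌊P⌋₊ := by
    exact_mod_cast Nat.floor_pos.mpr (by linarith)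
  refine h.trans ?_
  have := Real.log_le_log h2 h1
  have h3 := Real.log_natCast_nonneg ⌊P⌋₊
  gcongr

/-- The difference is supported on proper prime powers, so it is at most `ψ(P) - θ(P)`. -/
theorem norm_lambdaSum_sub_primeSum_le {P : ℝ} (hP : 2 ≤ P) (α β : ℝ) :
    ‖lambdaSum P 0 α β - primeSum P α β‖ ≤ 2 * √P * Real.log P := by
  have e : lambdaSum P 0 α β - primeSum P α β =
      ∑ n ∈ (Finset.Icc 1 ⌊P⌋₊).filter (fun n => ¬ n.Prime), (Λ n : ℂ) * cubicPhase 0 α β n := by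
    rw [lambdaSum_eq, ← Finset.sum_filter_add_sum_filter_not _ Nat.Prime, add_comm,
      add_sub_assoc, add_eq_left, sub_eq_zero]
    refine Finset.sum_congr rfl fun p hp => ?_
    rw [ArithmeticFunction.vonMangoldt_apply_prime (Finset.mem_filter.mp hp).2]
    unfold cubicPhase
    rw [zero_mul, zero_add]
    rfl
  rw [e]
  refine le_trans ?_ (Chebyshev.psi_sub_theta_le (by linarith : 1 ≤ P))
  rw [Chebyshev.psi_sub_theta_eq_sum_not_prime]
  refine norm_sum_le_of_le _ fun n _ => ?_
  rw [norm_mul, norm_cubicPhase, mul_one, Complex.norm_real, Real.norm_eq_abs,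
    abs_of_nonneg ArithmeticFunction.vonMangoldt_nonneg]

theorem eventually_log_pow_le (k : ℕ) {c : ℝ} (hc : 0 < c) :
    ∀ᶠ P : ℝ in Filter.atTop, Real.log P ^ k ≤ c * P := by
  have h := (Real.isLittleO_pow_log_id_atTop (n := k)).bound hc
  filter_upwards [h, Filter.eventually_ge_atTop 1] with P h1 h2
  simp only [id, Real.norm_eq_abs] at h1
  rw [abs_of_nonneg (show (0 : ℝ) ≤ P by linarith)] at h1
  exact (le_abs_self _).trans h1

/-- For large `P`, the sum over `Λ` is small on the minor arcs. -/
theorem exists_minor_arc_bound (m : ℕ) (hm : 1 ≤ m) : ∃ k : ℕ, ∃ P₀ : ℝ, ∀ P : ℝ, P₀ ≤ P →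
    ∀ A : ℝ, (k : ℝ) ≤ A → ∀ α₁ α₂ α₃ : ℝ,
    ((α₂ : UnitAddCircle), (α₃ : UnitAddCircle)) ∈ minorArcs A P →
    ‖lambdaSum P α₁ α₂ α₃‖ ≤ P / Real.log P ^ m := by
  obtain ⟨K, hK, hsum⟩ := vonMangoldt_sum_cubic
  -- The extra power of `log P` absorbs the factors `4` and `8` from `⌊P⌋ ≥ P / 2` and makes `q <
  -- (log P) ^ A` strict.
  refine ⟨m * K + 1, ?_⟩
  have hev := (eventually_log_pow_le (m * K) (by norm_num : (0 : ℝ) < 1 / 2)).and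
    ((Filter.eventually_ge_atTop (2 : ℝ)).and
      (Real.tendsto_log_atTop.eventually_ge_atTop 100))
  obtain ⟨P₀, hP₀⟩ := Filter.eventually_atTop.mp hev
  refine ⟨P₀, fun P hP A hA α₁ α₂ α₃ hminor => ?_⟩
  obtain ⟨hlogP, hP2, hL⟩ := hP₀ P hP
  set L := Real.log P with hLdef
  have hL1 : 1 ≤ L := by linarith
  have hL0 : 0 < L := by linarith
  have hP0 : 0 < P := by linarith
  set X := ⌊P⌋₊ with hX
  have hXP : (X : ℝ) ≤ P := Nat.floor_le hP0.le
  have hPX : P / 2 ≤ X := by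
    have := Nat.sub_one_lt_floor P
    linarith
  have hX0 : (0 : ℝ) < X := by linarith
  by_contra! hlt
  refine hminor ?_
  obtain ⟨q, hq1, hqQ, hq2, hq3⟩ := hsum (Q := L ^ m) (X := X)
    (hL.trans (le_self_pow₀ hL1 (by omega))) (by rw [← pow_mul]; linarith)
    ((Real.log_le_log hX0 hXP).trans (le_self_pow₀ hL1 (by omega)))
    (α₁ := α₁) (α₂ := α₂) (α₃ := α₃) (by
      rw [← lambdaSum_eq]
      exact le_trans (by gcongr) hlt.le)
  rw [← pow_mul] at hqQ hq2 hq3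
  have hLA : L * L ^ (m * K) ≤ L ^ A := by
    calc L * L ^ (m * K) = L ^ ((m * K + 1 : ℕ) : ℝ) := by rw [Real.rpow_natCast]; ring
      _ ≤ L ^ A := Real.rpow_le_rpow_of_exponent_le hL1 hA
  have hpos : 0 < L ^ (m * K) := by positivity
  refine mem_majorArcs hq1 (by nlinarith) (hq2.trans ?_) (hq3.trans ?_)
  · calc L ^ (m * K) / (X : ℝ) ^ 2 ≤ L ^ (m * K) / (P / 2) ^ 2 := by gcongr
      _ = 4 * L ^ (m * K) / P ^ 2 := by field_simp; norm_num
      _ ≤ L * L ^ (m * K) / P ^ 2 := by gcongr; linarith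
      _ ≤ _ := by gcongr
  · calc L ^ (m * K) / (X : ℝ) ^ 3 ≤ L ^ (m * K) / (P / 2) ^ 3 := by gcongr
      _ = 8 * L ^ (m * K) / P ^ 3 := by field_simp; norm_num
      _ ≤ L * L ^ (m * K) / P ^ 3 := by gcongr; linarith
      _ ≤ _ := by gcongr

theorem exists_prime_power_bound (m : ℕ) : ∃ P₀ : ℝ, ∀ P : ℝ, P₀ ≤ P →
    2 * √P * Real.log P ≤ P / Real.log P ^ m := by
  have hev := (eventually_log_pow_le (2 * (m + 1)) (by norm_num : (0 : ℝ) < 1 / 4)).and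
    ((Filter.eventually_ge_atTop (2 : ℝ)).and
      (Real.tendsto_log_atTop.eventually_ge_atTop 1))
  obtain ⟨P₀, hP₀⟩ := Filter.eventually_atTop.mp hev
  refine ⟨P₀, fun P hP => ?_⟩
  obtain ⟨h1, hP2, hL⟩ := hP₀ P hP
  have hP0 : 0 ≤ P := by linarith
  have h2 : Real.log P ^ (m + 1) ≤ √P / 2 := by
    refine le_of_sq_le_sq ?_ (by positivity)
    rw [div_pow, Real.sq_sqrt hP0, ← pow_mul, mul_comm]
    linarith
  rw [le_div_iff₀ (by positivity)]
  calc 2 * √P * Real.log P * Real.log P ^ m = 2 * √P * Real.log P ^ (m + 1) := by ring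
    _ ≤ 2 * √P * (√P / 2) := by gcongr
    _ = √P * √P := by ring
    _ = P := Real.mul_self_sqrt hP0

end CubicWeyl

theorem mainTheorem4 :
    ∀ D : ℝ, 0 < D → ∃ A₀ : ℝ, 0 < A₀ ∧ ∀ A : ℝ, A₀ ≤ A → ∃ C : ℝ, 0 < C ∧
      ∀ P : ℝ, 2 ≤ P →
        (∀ α₁ α₂ α₃ : ℝ,
          ((α₂ : UnitAddCircle), (α₃ : UnitAddCircle)) ∈ CubicWeyl.minorArcs A P →
            ‖CubicWeyl.lambdaSum P α₁ α₂ α₃‖ ≤ C * (P * Real.log P ^ (-D))) ∧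
        (BddAbove (CubicWeyl.minorArcValues A P) ∧
          sSup (CubicWeyl.minorArcValues A P) ≤ C * (P * Real.log P ^ (-D))) := by
  intro D hD
  set m := ⌈D⌉₊ with hm
  have hm1 : 1 ≤ m := Nat.ceil_pos.mpr hD
  obtain ⟨k, P₁, hP₁⟩ := CubicWeyl.exists_minor_arc_bound m hm1
  obtain ⟨P₂, hP₂⟩ := CubicWeyl.exists_prime_power_bound m
  refine ⟨k + 1, by positivity, fun A hA => ?_⟩
  set P₀ := max (max P₁ P₂) (Real.exp 1) with hP₀
  have he : Real.exp 1 ≤ P₀ := le_max_right _ _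
  have hP₀0 : 0 < P₀ := (Real.exp_pos 1).trans_le he
  have hL₀ : 1 ≤ Real.log P₀ := by rwa [Real.le_log_iff_exp_le hP₀0]
  -- For `P ≤ P₀` the trivial bound `3 P log P` equals `3 (log P) ^ (1 + D)` times `P (log P) ^
  -- (-D)`, which dictates this constant.
  set C₀ := 3 * Real.log P₀ ^ (1 + D) with hC₀
  have hC₀3 : 3 ≤ C₀ := by
    have := Real.one_le_rpow hL₀ (by linarith : 0 ≤ 1 + D)
    linarith
  refine ⟨C₀, by linarith, fun P hP => ?_⟩
  have hP0 : 0 < P := by linarith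
  have hL : 0 < Real.log P := Real.log_pos (by linarith)
  -- Including the prime power error here lets one estimate yield both statements.
  have hbound : ∀ α₁ α₂ α₃ : ℝ,
      ((α₂ : UnitAddCircle), (α₃ : UnitAddCircle)) ∈ CubicWeyl.minorArcs A P →
      ‖CubicWeyl.lambdaSum P α₁ α₂ α₃‖ + 2 * √P * Real.log P ≤
        C₀ * (P * Real.log P ^ (-D)) := by
    intro α₁ α₂ α₃ hminor
    rcases le_total P₀ P with hPP | hPP
    · have h1 := hP₁ P ((le_max_left _ _).trans ((le_max_left _ _).trans hPP)) A (by linarith)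
        α₁ α₂ α₃ hminor
      have h2 := hP₂ P ((le_max_right _ _).trans ((le_max_left _ _).trans hPP))
      have hL1 : 1 ≤ Real.log P := hL₀.trans (Real.log_le_log hP₀0 hPP)
      have h3 : P / Real.log P ^ m ≤ P * Real.log P ^ (-D) := by
        rw [div_eq_mul_inv, ← Real.rpow_natCast, ← Real.rpow_neg hL.le]
        gcongr
        exact Nat.le_ceil D
      have h4 : 0 ≤ P * Real.log P ^ (-D) := by positivity
      nlinarith
    · have h1 := CubicWeyl.norm_lambdaSum_le hP α₁ α₂ α₃
      have h2 : √P ≤ P := Real.sqrt_le_iff.mpr ⟨by linarith, by nlinarith⟩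
      have h3 : 2 * √P * Real.log P ≤ 2 * P * Real.log P := by gcongr
      have h4 : Real.log P ^ (1 + D) ≤ Real.log P₀ ^ (1 + D) :=
        Real.rpow_le_rpow hL.le (Real.log_le_log hP0 hPP) (by linarith)
      calc _ ≤ 3 * (P * Real.log P) := by linarith
        _ = 3 * Real.log P ^ (1 + D) * (P * Real.log P ^ (-D)) := by
          have : Real.log P ^ (1 + D) * Real.log P ^ (-D) = Real.log P := by
            rw [← Real.rpow_add hL]; simp
          linear_combination (-3 * P) * this
        _ ≤ _ := by rw [hC₀]; gcongr
  have hrest : 0 ≤ 2 * √P * Real.log P := by positivity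
  have hvalues : ∀ r ∈ CubicWeyl.minorArcValues A P, r ≤ C₀ * (P * Real.log P ^ (-D)) := by
    rintro r ⟨α, β, hminor, rfl⟩
    have h1 := CubicWeyl.norm_lambdaSum_sub_primeSum_le hP α β
    have h2 := norm_sub_norm_le (CubicWeyl.primeSum P α β) (CubicWeyl.lambdaSum P 0 α β)
    rw [norm_sub_rev] at h2
    linarith [hbound 0 α β hminor]
  refine ⟨fun α₁ α₂ α₃ hminor => ?_, ⟨_, hvalues⟩, Real.sSup_le hvalues ?_⟩
  · linarith [hbound α₁ α₂ α₃ hminor]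
  · have : 0 < C₀ := by linarith
    positivity
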